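/- A plane partition in an $a\times b\times c$ box is a set of unit cubes $(i,j,k)$ of the box, $1\le i\le a$, $1\le j\le b$, $1\le k\le c$, closed under decreasing any coordinate; $N(a,b,c)$ is the number of them. A plane partition $\pi$ in an $m\times b\times b$ box is transpose-complement (a TCPP) if for all $i,j,k$ exactly one of the cubes $(i,j,k)$ and $(m+1-i,\,b+1-k,\,b+1-j)$ belongs to $\pi$; $N_6(m,b,b)$ is the number of TCPPs. Let $Z(a,b,c)$ be the bipartite honeycomb graph whose vertices are the unit triangles (up = white, down = black) of the hexagon with sides $a,b,c,a,b,c$ in the triangular lattice, two being adjacent when they share a side. The color-preserving reflection of $Z(m,b,b)$ is the one in the line through the midpoints of the two sides of length $m$; let $Q(m,b)$ be the quotient of $Z(m,b,b)$ by it. Vertices fixed by the reflection are said to be on the axis. Give weight $2$ to each edge of $Q(m,b)$ that joins a white vertex on the axis to a black vertex not on the axis, and weight $1$ to every other edge, and let $N_6(m,b,b)_2$ be the sum over all perfect matchings of $Q(m,b)$ of the product of the weights of their edges. (For $m$ even, the matchings that use all edges along the axis correspond to the TCPPs, and they have weight $1$.) The Kasteleyn curvature of a face $F$ is $(-1)^{|F|/2+1}\prod_{e\in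 F_+}\omega(e)/\prod_{e\in F_-}\omega(e)$, where $\omega$ is the weight and $F_+$, respectively $F_-$, is the set of edges of $F$ which, directed from black to white, agree, respectively disagree, with the orientation of $F$. Then the following hold. 1. For all integers $m,b\ge 0$ and a suitable orientation of the plane, the weighting of $Q(m,b)$ has curvature $2$ at every hexagonal face that contains an edge along the axis, and curvature $1$ at every other hexagonal face. 2. For all integers $a,b\ge 0$, $$N(2a,b,b)=N_6(2a,b,b)\,N_6(2a,b,b)_2 .$$ 3. For all integers $a\ge 0$, $b\ge 1$, $$N(2a+1,b,b)=2\,N_6(2a,b+1,b+1)\,N_6(2a+2,b-1,b-1)_2 .$$ 4. For all integers $a\ge 0$, $b\ge 1$, $$N_6(2a,b,b)=\binom{a+b-1}{b-1}\prod_{1\le i\le j\le b-2}\frac{2a+i+j+1}{i+j+1}.$$ -/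

import Mathlib

/-- A plane partition in an `a × b × c` box: a set of unit cubes `(i, j, k)` of the box that is
closed under decreasing any coordinate (below, behind and to the left of each cube there is another
cube or a wall). -/
abbrev PlanePartition (a b c : ℕ) : Type := LowerSet (Fin a × Fin b × Fin c)

/-- `N(a, b, c)`: the number of plane partitions in an `a × b × c` box. -/
noncomputable def numPP (a b c : ℕ) : ℕ := Nat.card (PlanePartition a b c)

/-- A plane partition in an `m × b × b` box is transpose-complement if its transpose (exchange of
the last two coordinates) is its complement: of the cube `(i, j, k)` and its image
`(m + 1 - i, b + 1 - k, b + 1 - j)` (in coordinates starting at 1; `Fin.rev` reverses a coordinate)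
exactly one is filled. -/
def PlanePartition.IsTransposeComplement {m b : ℕ} (π : PlanePartition m b b) : Prop :=
  ∀ (i : Fin m) (j k : Fin b), (i, j, k) ∈ π ↔ (i.rev, k.rev, j.rev) ∉ π

/-- `N₆(m, b, b)`: the number of transpose-complement plane partitions in an `m × b × b` box. -/
noncomputable def numTCPP (m b : ℕ) : ℕ :=
  Nat.card {π : PlanePartition m b b // π.IsTransposeComplement}

namespace Honeycomb

/-- A unit triangle of the triangular lattice (a vertex of the dual honeycomb) is recorded by the
indices of the strips that contain it, one index for each of the three directions of lattice
lines. -/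
abbrev Vertex : Type := ℕ × ℕ × ℕ

/-- The three directions of the edges of the honeycomb, from white to black. -/
def e₁ : Vertex := (1, 0, 0)
/-- The second edge direction. -/
def e₂ : Vertex := (0, 1, 0)
/-- The third edge direction. -/
def e₃ : Vertex := (0, 0, 1)

/-- A white vertex `w` and a black vertex `v` are adjacent when the two triangles share a side. -/
def Adj (w v : Vertex) : Prop := v = w + e₁ ∨ v = w + e₂ ∨ v = w + e₃

instance : DecidableRel Adj := fun w v =>
  inferInstanceAs (Decidable (v = w + e₁ ∨ v = w + e₂ ∨ v = w + e₃))

/-- The triangles in the hexagon with sides `a, b, c, a, b, c`: the two sides of length `a` bound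
the strips with first index `0, …, b + c - 1`, and so on. -/
def region (a b c : ℕ) : Finset Vertex :=
  Finset.range (b + c) ×ˢ Finset.range (a + c) ×ˢ Finset.range (a + b)

/-- The white vertices of the graph `Z(a, b, c)`. -/
def white (a b c : ℕ) : Finset Vertex :=
  (region a b c).filter fun x => x.1 + x.2.1 + x.2.2 + 2 = a + b + c

/-- The black vertices of the graph `Z(a, b, c)`. -/
def black (a b c : ℕ) : Finset Vertex :=
  (region a b c).filter fun x => x.1 + x.2.1 + x.2.2 + 1 = a + b + c

/-- The color-preserving reflection of `Z(m, b, b)`. -/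
def reflect (x : Vertex) : Vertex := (x.1, x.2.2, x.2.1)

/-- A vertex is on the axis if the reflection fixes it. -/
def OnAxis (x : Vertex) : Prop := reflect x = x

instance : DecidablePred OnAxis := fun x => inferInstanceAs (Decidable (reflect x = x))

/-- The white vertices of the quotient of `Z(m, b, b)` by the reflection. Each orbit is represented
by its vertex in the closed half `x.2.1 ≤ x.2.2`. No edge of `Z(m, b, b)` joins the two open
halves, so the quotient graph is the subgraph of `Z(m, b, b)` that lies in this closed half. -/
def quotWhite (m b : ℕ) : Finset Vertex := (white m b b).filter fun x => x.2.1 ≤ x.2.2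

/-- The black vertices of the quotient of `Z(m, b, b)` by the reflection. -/
def quotBlack (m b : ℕ) : Finset Vertex := (black m b b).filter fun x => x.2.1 ≤ x.2.2

/-- The perfect matchings of the bipartite graph with white vertices `W` and black vertices `B`:
a matching is given by the bijection that sends a white vertex to its partner. -/
def perfectMatchings (W B : Finset Vertex) : Finset (W ≃ B) :=
  Finset.univ.filter fun f => ∀ w : W, Adj w (f w)

/-- The weight of the edge from a white vertex `w` to a black vertex `v` in the quotient graph: `2`
if `w` is on the axis and `v` is not, and `1` otherwise. -/
def edgeWeight (w v : Vertex) : ℕ := if OnAxis w ∧ ¬ OnAxis v then 2 else 1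

/-- The 2-enumeration `N₆(m, b, b)₂`: the total weight of the perfect matchings of the quotient of
`Z(m, b, b)` by the reflection. For even `m` the matchings that use all edges along the axis
correspond to the transpose-complement plane partitions and have weight 1. -/
def numTCPPTwo (m b : ℕ) : ℕ :=
  ∑ f ∈ perfectMatchings (quotWhite m b) (quotBlack m b), ∏ w : quotWhite m b, edgeWeight w (f w)

/-- The six vertices around the lattice point with base `p` belong to the quotient of `Z(m, b, b)`,
that is, they bound a hexagonal face of it. -/
def IsQuotFace (m b : ℕ) (p : Vertex) : Prop :=
  (p + e₁ ∈ quotWhite m b ∧ p + e₂ ∈ quotWhite m b ∧ p + e₃ ∈ quotWhite m b) ∧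
  (p + e₁ + e₂ ∈ quotBlack m b ∧ p + e₂ + e₃ ∈ quotBlack m b ∧ p + e₃ + e₁ ∈ quotBlack m b)

/-- The face with base `p` contains an edge of the axis, namely the one from `p + e₂` to
`p + e₁ + e₂`. -/
def FaceAtAxis (p : Vertex) : Prop := OnAxis (p + e₂) ∧ OnAxis (p + e₁ + e₂)

/-- The Kasteleyn curvature of the edge weighting at the hexagonal face with base `p`: the sign
`(-1) ^ (|F| / 2 + 1)` times the product of the weights of the edges that run (from black to white)
along the orientation of the face, divided by the product of the weights of the other edges. -/
def curvature (p : Vertex) : ℚ :=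
  (-1) ^ (6 / 2 + 1) *
    ((edgeWeight (p + e₁) (p + e₁ + e₂) * edgeWeight (p + e₂) (p + e₂ + e₃) *
      edgeWeight (p + e₃) (p + e₃ + e₁) : ℕ) : ℚ) /
    ((edgeWeight (p + e₂) (p + e₁ + e₂) * edgeWeight (p + e₃) (p + e₂ + e₃) *
      edgeWeight (p + e₁) (p + e₃ + e₁) : ℕ) : ℚ)

end Honeycomb

/-! All three counts are evaluated as explicit products, and the two factorizations then become
identities between products; the reflection is not used to factor a matching count directly. Each
family is encoded as `chains`: sequences of strictly increasing rows with interlacing neighbours and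
a fixed last row. Plane partitions in an `m × b × b` box become triangular arrays read along the
diagonals of the height array (`heightFnsEquivChains`). TCPPs are determined by their parts above
half height, which form a plane partition of staircase shape, and these become half triangles
(`stairFnsEquivChains`). Matchings of the quotient graph become the same half triangles: an entry
marks a white vertex matched along the direction `e₁`, here called vertical, and the weight is 2 for
each even row whose first entry is nonzero (`chainMatching`, `matchingChain`,
`prod_edgeWeight_chainMatching`). Chains are summed row by row. Summing a determinant over a row
that interlaces the next one replaces the column functions by their discrete antiderivatives
(`sum_det_interlace_succ`, `sum_det_interlace_self`), so the total is one determinant in the last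
row. Its columns are nested polynomials in a single function `u`, so it is a Vandermonde product up
to a constant (`det_nested_prod`). The constant is found from the row `0, 1, 2, …`, where the matrix
is unitriangular. -/

open Finset

/-! ### Summing a determinant over interlacing rows. -/

/-- The functions `ℕ → ℕ` that take a value in `I i` at `i < k` and vanish from `k` on. -/
noncomputable def boxFns (k : ℕ) (I : ℕ → Finset ℕ) : Finset (ℕ → ℕ) := by
  classical
  exact (Fintype.piFinset fun i : Fin k => I i).image fun t i => if h : i < k then t ⟨i, h⟩ else 0

theorem mem_boxFns {k : ℕ} {I : ℕ → Finset ℕ} {t : ℕ → ℕ} :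
    t ∈ boxFns k I ↔ (∀ i < k, t i ∈ I i) ∧ ∀ i, k ≤ i → t i = 0 := by
  classical
  simp only [boxFns, mem_image, Fintype.mem_piFinset]
  constructor
  · rintro ⟨u, hu, rfl⟩
    exact ⟨fun i hi => by simpa [hi] using hu ⟨i, hi⟩, fun i hi => by simp [Nat.not_lt.2 hi]⟩
  · rintro ⟨h1, h2⟩
    refine ⟨fun i => t i, fun i => h1 i i.2, ?_⟩
    ext i
    by_cases hi : i < k
    · simp [hi]
    · simp [hi, h2 i (Nat.not_lt.1 hi)]

theorem sum_boxFns {k : ℕ} {I : ℕ → Finset ℕ} (F : (Fin k → ℕ) → ℚ) :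
    ∑ t ∈ boxFns k I, F (fun i => t i) = ∑ t ∈ Fintype.piFinset fun i : Fin k => I i, F t := by
  classical
  rw [boxFns, sum_image]
  · refine sum_congr rfl fun t _ => ?_
    simp
  · intro t _ u _ h
    ext i
    simpa using congrFun h i

/-- The determinant is multilinear in its rows, and the entries `t i` range independently. -/
theorem sum_boxFns_det {k : ℕ} {I : ℕ → Finset ℕ} (f : Fin k → Fin k → ℕ → ℚ) :
    ∑ t ∈ boxFns k I, (Matrix.of fun i j : Fin k => f i j (t i)).det =
      (Matrix.of fun i j : Fin k => ∑ y ∈ I i, f i j y).det := by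
  rw [sum_boxFns fun t => (Matrix.of fun i j : Fin k => f i j (t i)).det]
  have := (Matrix.detRowAlternating (R := ℚ) (n := Fin k)).toMultilinearMap.map_sum_finset
    (fun i y => fun j => f i j y) (fun i : Fin k => I i)
  convert this.symm using 2
  · congr 1
  · congr 1
    ext i j
    simp

/-- Summation of a determinant over a row of `n` entries that interlaces a row of `n + 1`. -/
theorem sum_det_interlace_succ {n : ℕ} {s : ℕ → ℕ} (hs : ∀ i < n, s i ≤ s (i + 1))
    (φ Φ : ℕ → ℕ → ℚ) (h0 : ∀ x, Φ 0 x = 1) (h : ∀ j x, Φ (j + 1) (x + 1) - Φ (j + 1) x = φ j x) :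
    ∑ t ∈ boxFns n (fun i => Ico (s i) (s (i + 1))),
      (Matrix.of fun i j : Fin n => φ j (t i)).det =
      (Matrix.of fun i j : Fin (n + 1) => Φ j (s i)).det := by
  rw [sum_boxFns_det fun _ j y => φ j y]
  have key : ∀ j : ℕ, ∀ i < n, ∑ y ∈ Ico (s i) (s (i + 1)), φ j y =
      Φ (j + 1) (s (i + 1)) - Φ (j + 1) (s i) := by
    intro j i hi
    rw [← sum_Ico_sub (fun y => Φ (j + 1) y) (hs i hi)]
    exact sum_congr rfl fun y _ => (h j y).symm
  symm
  -- Subtracting from each row its predecessor turns column 0, which is constantly 1, into `(1, 0,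
  -- …, 0)`. Expansion along it leaves the minor of differences of `Φ`, which are the telescoped
  -- sums of `key`.
  rw [Matrix.det_eq_of_forall_row_eq_smul_add_pred
    (B := Matrix.of fun i j : Fin (n + 1) =>
      Fin.cases (Φ j (s 0)) (fun i' : Fin n => Φ j (s (i' + 1)) - Φ j (s i')) i) (fun _ => 1)]
  · rw [Matrix.det_succ_column_zero, Fin.sum_univ_succ]
    simp only [Matrix.of_apply, Fin.cases_zero, Fin.cases_succ, Fin.val_zero, pow_zero, h0, sub_self,
      mul_zero, zero_mul, sum_const_zero, add_zero, one_mul]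
    congr 1
    ext i j
    simp [key j i i.2]
  · intro j
    simp
  · intro i j
    simp

/-- Summation of a determinant over a row of `k + 1` entries that interlaces another row of `k + 1`
entries, where the first entry carries the weight `w`. -/
theorem sum_det_interlace_self {k : ℕ} {s : ℕ → ℕ} (hs : ∀ i < k, s i ≤ s (i + 1))
    (w : ℕ → ℚ) (β : ℚ) (ψ α : ℕ → ℕ → ℚ) (h0 : ∀ j x, ∑ y ∈ Iic x, w y * ψ j y = α j x)
    (h : ∀ j x, ψ j (x + 1) = β * (α j (x + 1) - α j x)) :
    ∑ t ∈ boxFns (k + 1) (fun i => if i = 0 then Iic (s 0) else Ioc (s (i - 1)) (s i)),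
      w (t 0) * (Matrix.of fun i j : Fin (k + 1) => ψ j (t i)).det =
      β ^ k * (Matrix.of fun i j : Fin (k + 1) => α j (s i)).det := by
  -- The weight is absorbed into row 0, so that multilinearity applies.
  have h1 : ∀ t : ℕ → ℕ, w (t 0) * (Matrix.of fun i j : Fin (k + 1) => ψ j (t i)).det =
      (Matrix.of fun i j : Fin (k + 1) => (if i = 0 then w (t i) else 1) * ψ j (t i)).det := by
    intro t
    have := Matrix.det_mul_column (fun i : Fin (k + 1) => if i = 0 then w (t i) else 1)
      (Matrix.of fun i j : Fin (k + 1) => ψ j (t i))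
    rw [Fin.prod_univ_succ] at this
    simpa [Fin.succ_ne_zero] using this.symm
  simp only [h1]
  rw [sum_boxFns_det fun i j y => (if i = 0 then w y else 1) * ψ j y]
  have key : ∀ j : ℕ, ∀ i < k, ∑ y ∈ Ioc (s i) (s (i + 1)), ψ j y =
      β * (α j (s (i + 1)) - α j (s i)) := by
    intro j i hi
    have hI : Ioc (s i) (s (i + 1)) = Ico (s i + 1) (s (i + 1) + 1) := by
      ext y
      simp only [mem_Ioc, mem_Ico]
      omega
    rw [← sum_Ico_sub (fun y => α j y) (hs i hi), mul_sum, hI, ← sum_Ico_add' (fun y => ψ j y)]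
    exact sum_congr rfl fun y _ => h j y
  -- Row differences again, without expansion: row 0 is the full weighted sum up to `s 0`, and each
  -- of the other `k` rows contributes a factor `β`.
  have h2 := Matrix.det_eq_of_forall_row_eq_smul_add_pred
    (A := Matrix.of fun i j : Fin (k + 1) => α j (s i))
    (B := Matrix.of fun i j : Fin (k + 1) =>
      Fin.cases (α j (s 0)) (fun i' : Fin k => α j (s (i' + 1)) - α j (s i')) i) (fun _ => 1)
    (fun j => by simp) (fun i j => by simp)
  rw [h2]
  have h3 := Matrix.det_mul_column (fun i : Fin (k + 1) => if i = 0 then 1 else β)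
    (Matrix.of fun i j : Fin (k + 1) =>
      Fin.cases (α j (s 0)) (fun i' : Fin k => α j (s (i' + 1)) - α j (s i')) i)
  rw [Fin.prod_univ_succ] at h3
  simp only [Fin.succ_ne_zero, if_true, if_false, prod_const, card_univ, Fintype.card_fin,
    one_mul] at h3
  rw [← h3]
  congr 1
  ext i j
  refine Fin.cases ?_ (fun i => ?_) i
  · simp [h0]
  · simp [Fin.succ_ne_zero, key j i i.2]

/-! ### Chains of rows and their weighted sums as determinants. -/

/-- The sequences of rows `c 0, …, c n` that end with `c n = s` and in which every row is one of the
rows `pre r (c (r + 1))` that may precede the next one (`c r = 0` for `r > n`). -/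
noncomputable def chains (pre : ℕ → (ℕ → ℕ) → Finset (ℕ → ℕ)) :
    ℕ → (ℕ → ℕ) → Finset (ℕ → ℕ → ℕ)
  | 0, s => {Function.update (fun _ => 0) 0 s}
  | n + 1, s => by
    classical
    exact (pre n s).biUnion fun t => (chains pre n t).image fun c => Function.update c (n + 1) s

/-- The vanishing beyond row `n` makes a chain determined by its rows up to `n`, so that counting
functions counts arrays. -/
theorem mem_chains {pre : ℕ → (ℕ → ℕ) → Finset (ℕ → ℕ)} {n : ℕ} {s : ℕ → ℕ} {c : ℕ → ℕ → ℕ} :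
    c ∈ chains pre n s ↔ c n = s ∧ (∀ r < n, c r ∈ pre r (c (r + 1))) ∧ ∀ r, n < r → c r = 0 := by
  induction n generalizing s c with
  | zero =>
    simp only [chains, mem_singleton]
    constructor
    · rintro rfl
      refine ⟨by simp, by simp, fun r hr => ?_⟩
      rw [Function.update_of_ne (by omega)]
    · rintro ⟨h1, -, h3⟩
      ext r : 1
      rcases Nat.eq_zero_or_pos r with rfl | hr
      · simp [h1]
      · rw [h3 r hr, Function.update_of_ne (by omega)]
  | succ n ih =>
    simp only [chains, mem_biUnion, mem_image, ih]
    constructor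
    · rintro ⟨t, ht, d, ⟨h1, h2, h3⟩, rfl⟩
      refine ⟨by simp, fun r hr => ?_, fun r hr => ?_⟩
      · rw [Function.update_of_ne (by omega : r ≠ n + 1)]
        rcases Nat.lt_succ_iff_lt_or_eq.1 hr with hr' | rfl
        · rw [Function.update_of_ne (by omega)]
          exact h2 r hr'
        · rwa [Function.update_self, h1]
      · rw [Function.update_of_ne (by omega), h3 r (by omega)]
    · rintro ⟨h1, h2, h3⟩
      refine ⟨c n, h1 ▸ h2 n (by omega), Function.update c (n + 1) 0, ⟨?_, fun r hr => ?_,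
        fun r hr => ?_⟩, ?_⟩
      · rw [Function.update_of_ne (by omega)]
      · rw [Function.update_of_ne (by omega), Function.update_of_ne (by omega)]
        exact h2 r (by omega)
      · rcases eq_or_ne r (n + 1) with rfl | hr'
        · simp
        · rw [Function.update_of_ne hr', h3 r (by omega)]
      · rw [← h1]
        simp

theorem sum_chains_succ (pre : ℕ → (ℕ → ℕ) → Finset (ℕ → ℕ)) (w : ℕ → (ℕ → ℕ) → ℚ) (n : ℕ)
    (s : ℕ → ℕ) :
    ∑ c ∈ chains pre (n + 1) s, ∏ r ∈ range (n + 1), w r (c r) =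
      ∑ t ∈ pre n s, w n t * ∑ c ∈ chains pre n t, ∏ r ∈ range n, w r (c r) := by
  classical
  rw [chains, sum_biUnion]
  · refine sum_congr rfl fun t ht => ?_
    rw [sum_image, mul_sum]
    · refine sum_congr rfl fun c hc => ?_
      rw [prod_range_succ, mul_comm, Function.update_of_ne (by omega), (mem_chains.1 hc).1]
      congr 1
      refine prod_congr rfl fun r hr => ?_
      rw [Function.update_of_ne (by have := mem_range.1 hr; omega)]
    · intro c hc d hd h
      ext r : 1
      rcases eq_or_ne r (n + 1) with rfl | hr
      · rw [(mem_chains.1 hc).2.2 _ (by omega), (mem_chains.1 hd).2.2 _ (by omega)]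
      · have := congrFun h r
        simpa only [Function.update_of_ne hr] using this
  · intro t _ u _ htu
    rw [Function.onFun, disjoint_left]
    intro c hc hd
    obtain ⟨c', hc', rfl⟩ := mem_image.1 hc
    obtain ⟨d, hd', h⟩ := mem_image.1 hd
    apply htu
    have := congrFun h n
    rw [Function.update_of_ne (by omega), Function.update_of_ne (by omega), (mem_chains.1 hc').1,
      (mem_chains.1 hd').1] at this
    exact this.symm

/-- The rows of `r` entries that interlace a row `s` of `r + 1` entries. -/
noncomputable def triPre (r : ℕ) (s : ℕ → ℕ) : Finset (ℕ → ℕ) :=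
  boxFns r fun i => Ico (s i) (s (i + 1))

/-- The rows of `r / 2 + 1` entries that may precede `s` in a half triangle, where row `r + 1` has
`(r + 1) / 2 + 1` entries. -/
noncomputable def stairPre (r : ℕ) (s : ℕ → ℕ) : Finset (ℕ → ℕ) :=
  boxFns (r / 2 + 1) fun i =>
    if r % 2 = 0 then if i = 0 then Iic (s 0) else Ioc (s (i - 1)) (s i) else Ico (s i) (s (i + 1))

/-- By Pascal's rule `x.choose (j + 1)` is an antiderivative of `x.choose j`, so the same columns
recur at every level. Interlacing with half-open intervals keeps the rows strictly increasing. -/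
theorem sum_chains_triPre (n : ℕ) (s : ℕ → ℕ) (hs : ∀ i, i + 1 < n → s i < s (i + 1)) :
    ((chains triPre n s).card : ℚ) =
      (Matrix.of fun i j : Fin n => ((s i).choose j : ℚ)).det := by
  have key : ∀ (n : ℕ) (s : ℕ → ℕ), (∀ i, i + 1 < n → s i < s (i + 1)) →
      ∑ c ∈ chains triPre n s, ∏ r ∈ range n, (1 : ℚ) =
        (Matrix.of fun i j : Fin n => ((s i).choose j : ℚ)).det := by
    intro n
    induction n with
    | zero => intro s _; simp [chains]
    | succ n ih =>
      intro s hs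
      rw [sum_chains_succ triPre fun _ _ => 1]
      have h := sum_det_interlace_succ (n := n) (s := s) (fun i hi => (hs i (by omega)).le)
        (fun j x => (x.choose j : ℚ)) (fun j x => (x.choose j : ℚ)) (by simp) (by
          intro j x
          rw [Nat.choose_succ_succ]
          push_cast
          ring)
      rw [← h]
      refine sum_congr rfl fun t ht => ?_
      rw [one_mul, ih]
      intro i hi
      have h1 := (mem_boxFns.1 ht).1 i (by omega)
      have h2 := (mem_boxFns.1 ht).1 (i + 1) (by omega)
      rw [mem_Ico] at h1 h2
      omega
  rw [← key n s hs]
  simp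

/-- Two kinds of steps alternate: an odd row has as many entries as the even row before it (`h2`),
and an even row has one entry more than the odd row before it (`h1`). The first kind is assumed as
an identity of determinants, because in the weighted case powers of 2 move between columns. -/
theorem sum_chains_stairPre (w : ℕ → ℚ) (ψ φ : ℕ → ℕ → ℚ) (h0 : ∀ x, ψ 0 x = 1)
    (h1 : ∀ j x, ψ (j + 1) (x + 1) - ψ (j + 1) x = φ j x)
    (h2 : ∀ (k : ℕ) (s : ℕ → ℕ), (∀ i < k, s i ≤ s (i + 1)) →
      ∑ t ∈ boxFns (k + 1) (fun i => if i = 0 then Iic (s 0) else Ioc (s (i - 1)) (s i)),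
      w (t 0) * (Matrix.of fun i j : Fin (k + 1) => ψ j (t i)).det =
      (Matrix.of fun i j : Fin (k + 1) => φ j (s i)).det) (e : ℕ) :
    (∀ s : ℕ → ℕ, (∀ i < e, s i < s (i + 1)) →
      ∑ c ∈ chains stairPre (2 * e) s,
        ∏ r ∈ range (2 * e), (if r % 2 = 0 then w (c r 0) else 1) =
      (Matrix.of fun i j : Fin (e + 1) => ψ j (s i)).det) ∧
    (∀ s : ℕ → ℕ, (∀ i < e, s i < s (i + 1)) →
      ∑ c ∈ chains stairPre (2 * e + 1) s,
        ∏ r ∈ range (2 * e + 1), (if r % 2 = 0 then w (c r 0) else 1) =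
      (Matrix.of fun i j : Fin (e + 1) => φ j (s i)).det) := by
  have odd : ∀ e : ℕ, (∀ s : ℕ → ℕ, (∀ i < e, s i < s (i + 1)) →
      ∑ c ∈ chains stairPre (2 * e) s,
        ∏ r ∈ range (2 * e), (if r % 2 = 0 then w (c r 0) else 1) =
      (Matrix.of fun i j : Fin (e + 1) => ψ j (s i)).det) →
    (∀ s : ℕ → ℕ, (∀ i < e, s i < s (i + 1)) →
      ∑ c ∈ chains stairPre (2 * e + 1) s,
        ∏ r ∈ range (2 * e + 1), (if r % 2 = 0 then w (c r 0) else 1) =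
      (Matrix.of fun i j : Fin (e + 1) => φ j (s i)).det) := by
    intro e he s hs
    rw [sum_chains_succ stairPre fun r t => if r % 2 = 0 then w (t 0) else 1, ← h2 e s fun i hi => (hs i hi).le, stairPre]
    simp only [Nat.mul_mod_right, if_true, Nat.mul_div_cancel_left e (Nat.zero_lt_two)]
    refine sum_congr rfl fun t ht => ?_
    have := he t (fun i hi => ?_)
    · simpa using Or.inl this
    · have h3 := (mem_boxFns.1 ht).1 i (by omega)
      have h4 := (mem_boxFns.1 ht).1 (i + 1) (by omega)
      rw [if_neg (by omega), mem_Ioc, Nat.add_sub_cancel] at h4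
      split_ifs at h3 with h5
      · subst h5
        have := mem_Iic.1 h3
        omega
      · have := mem_Ioc.1 h3
        omega
  induction e with
  | zero =>
    refine ⟨fun s hs => ?_, odd 0 fun s hs => ?_⟩ <;> simp [chains, h0]
  | succ e ih =>
    have h : ∀ s : ℕ → ℕ, (∀ i < e + 1, s i < s (i + 1)) →
      ∑ c ∈ chains stairPre (2 * (e + 1)) s,
        ∏ r ∈ range (2 * (e + 1)), (if r % 2 = 0 then w (c r 0) else 1) =
      (Matrix.of fun i j : Fin (e + 1 + 1) => ψ j (s i)).det := by
      intro s hs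
      rw [show 2 * (e + 1) = 2 * e + 1 + 1 by ring,
        sum_chains_succ stairPre fun r t => if r % 2 = 0 then w (t 0) else 1,
        ← sum_det_interlace_succ (fun i hi => (hs i hi).le) φ ψ h0 h1, stairPre]
      simp only [show (2 * e + 1) % 2 = 1 by omega, show (2 * e + 1) / 2 = e by omega, one_ne_zero,
        if_false]
      refine sum_congr rfl fun t ht => ?_
      have := ih.2 t (fun i hi => ?_)
      · simpa using this
      · have h3 := (mem_boxFns.1 ht).1 i (by omega)
        have h4 := (mem_boxFns.1 ht).1 (i + 1) (by omega)
        rw [mem_Ico] at h3 h4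
        omega
    exact ⟨h, odd _ h⟩

/-- The columns are `(x + j).choose (2 * j)` on even rows and their partial sums `(x + 1 + j).choose
(2 * j + 1)` on odd rows; summing once more leads to the next even column. -/
theorem card_chains_stairPre (e : ℕ) (s : ℕ → ℕ) (hs : ∀ i < e, s i < s (i + 1)) :
    ((chains stairPre (2 * e + 1) s).card : ℚ) =
      (Matrix.of fun i j : Fin (e + 1) => ((s i + 1 + j).choose (2 * j + 1) : ℚ)).det := by
  rw [← (sum_chains_stairPre (fun _ => 1) (fun j x => ((x + j).choose (2 * j) : ℚ))
    (fun j x => ((x + 1 + j).choose (2 * j + 1) : ℚ)) (by simp) ?_ ?_ e).2 s hs]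
  · simp
  · intro j x
    rw [show x + 1 + (j + 1) = (x + 1 + j) + 1 by ring, show 2 * (j + 1) = (2 * j + 1) + 1 by ring,
      Nat.choose_succ_succ, show x + (j + 1) = x + 1 + j by ring]
    push_cast
    ring
  · intro k s hs
    have hstep : ∀ j x : ℕ, ((x + 1 + 1 + j).choose (2 * j + 1) : ℚ) =
        (x + 1 + j).choose (2 * j) + (x + 1 + j).choose (2 * j + 1) := by
      intro j x
      rw [show x + 1 + 1 + j = x + 1 + j + 1 by ring, Nat.choose_succ_succ]
      push_cast
      ring
    rw [sum_det_interlace_self hs (fun _ => 1) 1 (fun j x => ((x + j).choose (2 * j) : ℚ))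
      (fun j x => ((x + 1 + j).choose (2 * j + 1) : ℚ))]
    · simp
    · intro j x
      rw [← Nat.range_succ_eq_Iic]
      induction x with
      | zero =>
        rcases Nat.eq_zero_or_pos j with rfl | hj
        · simp
        · simp [Nat.choose_eq_zero_of_lt (show j < 2 * j by omega),
            Nat.choose_eq_zero_of_lt (show 1 + j < 2 * j + 1 by omega)]
      | succ x ih =>
        rw [sum_range_succ, ih, hstep]
        ring
    · intro j x
      rw [hstep]
      ring

/-- The column functions of odd rows in the 2-enumeration. -/
def twoCol (j x : ℕ) : ℚ := (x + j + 1).choose (2 * j + 1) + (x + j).choose (2 * j + 1)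

/-- The weight of the first entry of an even row in the 2-enumeration. -/
def twoWeight (x : ℕ) : ℚ := if x = 0 then 1 else 2

theorem sum_chains_twoWeight (e : ℕ) (s : ℕ → ℕ) (hs : ∀ i < e, s i < s (i + 1)) :
    ∑ c ∈ chains stairPre (2 * e + 1) s,
      ∏ r ∈ range (2 * e + 1), (if r % 2 = 0 then twoWeight (c r 0) else 1) =
      (Matrix.of fun i j : Fin (e + 1) => twoCol j (s i)).det := by
  -- Column 0 is half of what the pattern of the other columns would give. This causes the case
  -- distinction in `α`, the weighted partial sums of `ψ`; the factors 2 of its columns `j ≥ 1`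
  -- cancel against the power of `β = 1 / 2`.
  set ψ : ℕ → ℕ → ℚ := fun j x =>
    Nat.casesOn j 1 fun j => ((x + j + 1).choose (2 * j + 2) + (x + j).choose (2 * j + 2) : ℚ) with hψ
  set α : ℕ → ℕ → ℚ := fun j x => (if j = 0 then 1 else 2) * twoCol j x with hα
  have hstep : ∀ j x : ℕ, ψ j (x + 1) = 1 / 2 * (α j (x + 1) - α j x) := by
    intro j x
    rcases j with _ | j
    · simp only [hψ, hα, twoCol]
      norm_num
      ring
    · simp only [hψ, hα, twoCol]
      rw [show x + 1 + (j + 1) + 1 = x + j + 1 + 1 + 1 by ring,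
        show x + 1 + (j + 1) = x + j + 1 + 1 by ring, show x + (j + 1) + 1 = x + j + 1 + 1 by ring,
        show x + (j + 1) = x + j + 1 by ring, show 2 * (j + 1) + 1 = 2 * j + 2 + 1 by ring,
        show x + 1 + j + 1 = x + j + 1 + 1 by ring, show x + 1 + j = x + j + 1 by ring,
        Nat.choose_succ_succ (x + j + 1 + 1), Nat.choose_succ_succ (x + j + 1) (2 * j + 2)]
      rw [if_neg (by omega)]
      push_cast
      ring
  refine (sum_chains_stairPre twoWeight ψ twoCol (fun x => rfl) ?_ ?_ e).2 s hs
  · intro j x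
    simp only [hψ, twoCol]
    rw [show x + 1 + j + 1 = x + j + 1 + 1 by ring, show x + 1 + j = x + j + 1 by ring,
      Nat.choose_succ_succ (x + j + 1) (2 * j + 1), Nat.choose_succ_succ (x + j) (2 * j + 1)]
    push_cast
    ring
  · intro k s hs
    rw [sum_det_interlace_self hs twoWeight (1 / 2) ψ α ?_ hstep]
    · have := Matrix.det_mul_row (fun j : Fin (k + 1) => if (j : ℕ) = 0 then (1 : ℚ) else 2)
        (Matrix.of fun i j : Fin (k + 1) => twoCol j (s i))
      rw [Fin.prod_univ_succ] at this
      simp only [Fin.val_zero, if_true, Fin.val_succ, Nat.succ_ne_zero, if_false, prod_const,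
        card_univ, Fintype.card_fin, one_mul, Matrix.of_apply] at this
      simp only [hα]
      rw [this, ← mul_assoc, ← mul_pow]
      norm_num
    · intro j x
      rw [← Nat.range_succ_eq_Iic]
      induction x with
      | zero =>
        rcases j with _ | j
        · simp [hψ, hα, twoCol, twoWeight]
        · simp [hψ, hα, twoCol, twoWeight,
            Nat.choose_eq_zero_of_lt (show j + 1 < 2 * j + 2 by omega),
            Nat.choose_eq_zero_of_lt (show j < 2 * j + 2 by omega),
            Nat.choose_eq_zero_of_lt (show j + 1 + 1 < 2 * (j + 1) + 1 by omega),
            Nat.choose_eq_zero_of_lt (show j + 1 < 2 * (j + 1) + 1 by omega)]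
      | succ x ih =>
        rw [sum_range_succ, ih, hstep]
        simp [twoWeight]

/-! ### Evaluation of the determinants as Vandermonde products. -/

/-- A determinant whose columns are scaled monic polynomials in `u` with nested roots. -/
theorem det_nested_prod {n : ℕ} (f : ℕ → ℕ → ℚ) (κ e : ℕ → ℚ) (d u : ℕ → ℚ)
    (h0 : ∀ x, f 0 x = d x) (h : ∀ j x, f (j + 1) x = κ j * f j x * (u x - e j)) (x : ℕ → ℕ) :
    (Matrix.of fun i j : Fin n => f j (x i)).det =
      (∏ j : Fin n, ∏ t ∈ range j, κ t) * (∏ i : Fin n, d (x i)) *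
        ∏ i : Fin n, ∏ j ∈ Ioi i, (u (x j) - u (x i)) := by
  have hf : ∀ j y, f j y = (∏ t ∈ range j, κ t) * (d y * ∏ t ∈ range j, (u y - e t)) := by
    intro j y
    induction j with
    | zero => simp [h0]
    | succ j ih =>
      rw [h, ih, prod_range_succ, prod_range_succ]
      ring
  set p : Fin n → Polynomial ℚ := fun j => ∏ t ∈ range (j : ℕ), (Polynomial.X - Polynomial.C (e t))
    with hp
  have hdeg : ∀ j, (p j).natDegree = j := by
    intro j
    simp [hp, Polynomial.natDegree_prod_of_monic _ _ fun t _ => Polynomial.monic_X_sub_C (e t)]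
  have hmon : ∀ j, (p j).Monic := fun j =>
    Polynomial.monic_prod_of_monic _ _ fun t _ => Polynomial.monic_X_sub_C (e t)
  -- Apart from the row factor `d` and the column factors `κ`, column `j` is a monic polynomial of
  -- degree `j` in `u`, so column operations reduce the matrix to the Vandermonde matrix.
  have hv := Matrix.det_eval_matrixOfPolynomials_eq_det_vandermonde
    (fun i : Fin n => u (x i)) p hdeg hmon
  rw [Matrix.det_vandermonde] at hv
  rw [hv, mul_assoc, ← Matrix.det_mul_column, ← Matrix.det_mul_row]
  congr 1
  ext i j
  simp [hf, hp, Polynomial.eval_prod]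

theorem cast_choose_succ_mul (n k : ℕ) :
    (n.choose (k + 1) : ℚ) * (k + 1) = n.choose k * (n - k) := by
  have := Nat.choose_succ_right_eq n k
  rcases le_or_gt k n with h | h
  · have h' : ((n.choose (k + 1) * (k + 1) : ℕ) : ℚ) = ((n.choose k * (n - k) : ℕ) : ℚ) := by
      rw [this]
    rw [← Nat.cast_sub h]
    exact_mod_cast h'
  · rw [Nat.choose_eq_zero_of_lt h, Nat.choose_eq_zero_of_lt (by omega : n < k + 1)]
    simp

theorem cast_choose_succ_add_two_mul (n k : ℕ) :
    ((n + 1).choose (k + 2) : ℚ) * ((k + 1) * (k + 2)) = n.choose k * ((n + 1) * (n - k)) := by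
  have h1 : ((n + 1 : ℕ) * n.choose (k + 1) : ℚ) = (n + 1).choose (k + 2) * (k + 2 : ℕ) := by
    exact_mod_cast Nat.add_one_mul_choose_eq n (k + 1)
  have h2 := cast_choose_succ_mul n k
  push_cast at h1
  linear_combination (n + 1 : ℚ) * h2 - (k + 1 : ℚ) * h1

/-- The constant depends on `n` only and stays implicit here and in the two analogues below; it
drops out on comparison with the row `0, 1, …, n - 1`. -/
theorem det_choose {n : ℕ} : ∃ C : ℚ, ∀ x : ℕ → ℕ,
    (Matrix.of fun i j : Fin n => ((x i).choose j : ℚ)).det =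
      C * ∏ i : Fin n, ∏ j ∈ Ioi i, ((x j : ℚ) - x i) :=
  ⟨_, fun x => by
    rw [det_nested_prod (fun j x => (x.choose j : ℚ)) (fun j => 1 / (j + 1)) (fun j => j)
      (fun _ => 1) (fun x => x) (by simp) _ x, prod_const_one, mul_one]
    intro j x
    have := cast_choose_succ_mul x j
    field_simp
    linear_combination this⟩

/-- Consecutive columns differ by a multiple of `(x + j + 2) * (x - j) = (x + 1) ^ 2 - (j + 1) ^ 2`,
hence `u = (x + 1) ^ 2`. -/
theorem det_choose_odd {n : ℕ} : ∃ C : ℚ, ∀ x : ℕ → ℕ,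
    (Matrix.of fun i j : Fin n => ((x i + 1 + j).choose (2 * j + 1) : ℚ)).det =
      C * (∏ i : Fin n, ((x i : ℚ) + 1)) *
        ∏ i : Fin n, ∏ j ∈ Ioi i, (((x j : ℚ) + 1) ^ 2 - (x i + 1) ^ 2) :=
  ⟨_, fun x => by
    rw [det_nested_prod (fun j x => ((x + 1 + j).choose (2 * j + 1) : ℚ))
      (fun j => 1 / ((2 * j + 2) * (2 * j + 3))) (fun j => (j + 1) ^ 2)
      (fun x => x + 1) (fun x => (x + 1) ^ 2) (by simp) _ x]
    intro j x
    have := cast_choose_succ_add_two_mul (x + 1 + j) (2 * j + 1)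
    rw [show x + 1 + (j + 1) = x + 1 + j + 1 by ring, show 2 * (j + 1) + 1 = 2 * j + 1 + 2 by ring]
    push_cast at this
    field_simp
    linear_combination this⟩

theorem twoCol_eq (j x : ℕ) : twoCol j x = (2 * x + 1) / (2 * j + 1) * (x + j).choose (2 * j) := by
  have h1 : ((x + j + 1).choose (2 * j + 1) : ℚ) =
      (x + j).choose (2 * j) + (x + j).choose (2 * j + 1) := by
    rw [Nat.choose_succ_succ]
    push_cast
    ring
  have h2 := cast_choose_succ_mul (x + j) (2 * j)
  rw [twoCol, h1]
  push_cast at h2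
  field_simp
  linear_combination 2 * h2

/-- Here the ratio of columns contains `(x + j + 1) * (x - j) = x * (x + 1) - j * (j + 1)`, hence `u
= x * (x + 1)`. -/
theorem det_twoCol {n : ℕ} : ∃ C : ℚ, ∀ x : ℕ → ℕ,
    (Matrix.of fun i j : Fin n => twoCol j (x i)).det =
      C * (∏ i : Fin n, (2 * (x i : ℚ) + 1)) *
        ∏ i : Fin n, ∏ j ∈ Ioi i, ((x j : ℚ) * (x j + 1) - x i * (x i + 1)) :=
  ⟨_, fun x => by
    rw [det_nested_prod twoCol (fun j => 1 / ((2 * j + 2) * (2 * j + 3))) (fun j => j * (j + 1))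
      (fun x => 2 * x + 1) (fun x => x * (x + 1)) (by simp [twoCol_eq]) _ x]
    intro j x
    have := cast_choose_succ_add_two_mul (x + j) (2 * j)
    rw [twoCol_eq, twoCol_eq, show x + (j + 1) = x + j + 1 by ring,
      show 2 * (j + 1) = 2 * j + 2 by ring]
    push_cast at this ⊢
    field_simp
    linear_combination (2 * j + 3) * this⟩

theorem Fin.prod_prod_Ioi (n : ℕ) (f : ℕ → ℕ → ℚ) :
    ∏ i : Fin n, ∏ j ∈ Ioi i, f i j = ∏ j ∈ range n, ∏ i ∈ range j, f i j := by
  rw [prod_comm' (t' := univ) (s' := fun j => Iio j) (by simp),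
    ← Fin.prod_univ_eq_prod_range fun j => ∏ i ∈ range j, f i j]
  refine prod_congr rfl fun j _ => ?_
  rw [← Nat.Iio_eq_range, ← Fin.map_valEmbedding_Iio, prod_map]
  rfl

theorem Matrix.det_eq_one_of_unitriangular {n : ℕ} (f : ℕ → ℕ → ℚ) (h0 : ∀ i, f i i = 1)
    (h1 : ∀ i j, i < j → f i j = 0) : (Matrix.of fun i j : Fin n => f i j).det = 1 := by
  rw [Matrix.det_of_isLowerTriangular]
  · simp [h0]
  · intro i j hij
    exact h1 i j hij

/-! ### Product formulas for the last rows that occur. -/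

/-- The row `a, a + 1, …, a + n - 1`. -/
def shiftRow (a n i : ℕ) : ℕ := if i < n then a + i else 0

theorem shiftRow_lt {a n i : ℕ} (h : i + 1 < n) : shiftRow a n i < shiftRow a n (i + 1) := by
  rw [shiftRow, shiftRow, if_pos h, if_pos (by omega)]
  omega

/-- The difference of squares is `(j - i) * (2 * a + 2 + i + j)`, and `j - i` cancels against the
row with `a = 0`. The linear factors `x + 1` supply the diagonal `i = j` of the triangle. -/
theorem card_chains_stairPre_shiftRow (a n : ℕ) :
    ((chains stairPre (2 * n + 1) (shiftRow a (n + 1))).card : ℚ) =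
      ∏ j ∈ range (n + 1), ∏ i ∈ range (j + 1), ((2 * a + 2 + i + j : ℚ) / (2 + i + j)) := by
  rw [card_chains_stairPre n (shiftRow a (n + 1)) fun i hi => shiftRow_lt (by omega)]
  obtain ⟨C, hC⟩ := det_choose_odd (n := n + 1)
  have h1 := hC fun i => i
  rw [Matrix.det_eq_one_of_unitriangular (fun i j => ((i + 1 + j).choose (2 * j + 1) : ℚ))
    (fun i => by rw [show i + 1 + i = 2 * i + 1 by ring, Nat.choose_self, Nat.cast_one])
    (fun i j h => by rw [Nat.choose_eq_zero_of_lt (by omega), Nat.cast_zero])] at h1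
  rw [hC]
  have e1 : ∀ i : Fin (n + 1), shiftRow a (n + 1) i = a + i := fun i => if_pos i.2
  simp only [e1]
  rw [Fin.prod_univ_eq_prod_range (fun i => ((a + i : ℕ) : ℚ) + 1),
    Fin.prod_prod_Ioi _ fun i j => (((a + j : ℕ) : ℚ) + 1) ^ 2 - ((a + i : ℕ) + 1) ^ 2]
  rw [Fin.prod_univ_eq_prod_range (fun i => (i : ℚ) + 1),
    Fin.prod_prod_Ioi _ fun i j => ((j : ℚ) + 1) ^ 2 - (i + 1) ^ 2] at h1
  have key : (∏ i ∈ range (n + 1), (((a + i : ℕ) : ℚ) + 1)) * ∏ j ∈ range (n + 1), ∏ i ∈ range j,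
      ((((a + j : ℕ) : ℚ) + 1) ^ 2 - ((a + i : ℕ) + 1) ^ 2) =
      (∏ j ∈ range (n + 1), ∏ i ∈ range (j + 1), ((2 * a + 2 + i + j : ℚ) / (2 + i + j))) *
        ((∏ i ∈ range (n + 1), ((i : ℚ) + 1)) * ∏ j ∈ range (n + 1), ∏ i ∈ range j,
          (((j : ℚ) + 1) ^ 2 - (i + 1) ^ 2)) := by
    simp only [← prod_mul_distrib]
    refine prod_congr rfl fun j _ => ?_
    rw [prod_range_succ]
    have : ∏ i ∈ range j, ((((a + j : ℕ) : ℚ) + 1) ^ 2 - ((a + i : ℕ) + 1) ^ 2) =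
        (∏ i ∈ range j, ((2 * a + 2 + i + j : ℚ) / (2 + i + j))) *
          ∏ i ∈ range j, (((j : ℚ) + 1) ^ 2 - (i + 1) ^ 2) := by
      rw [← prod_mul_distrib]
      refine prod_congr rfl fun i _ => ?_
      push_cast
      field_simp
      ring
    rw [this]
    push_cast
    field_simp
    ring
  rw [mul_assoc, key]
  linear_combination -(∏ j ∈ range (n + 1), ∏ i ∈ range (j + 1),
    ((2 * a + 2 + i + j : ℚ) / (2 + i + j))) * h1

/-- The differences of `x * (x + 1)` are `(j - i) * (2 * a + 1 + i + j)`; the diagonal comes from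
the factors `2 * x + 1`. -/
theorem sum_chains_twoWeight_shiftRow (a n : ℕ) :
    ∑ c ∈ chains stairPre (2 * n + 1) (shiftRow a (n + 1)),
      ∏ r ∈ range (2 * n + 1), (if r % 2 = 0 then twoWeight (c r 0) else 1) =
      ∏ j ∈ range (n + 1), ∏ i ∈ range (j + 1), ((2 * a + 1 + i + j : ℚ) / (1 + i + j)) := by
  rw [sum_chains_twoWeight n (shiftRow a (n + 1)) fun i hi => shiftRow_lt (by omega)]
  obtain ⟨C, hC⟩ := det_twoCol (n := n + 1)
  have h1 := hC fun i => i
  rw [Matrix.det_eq_one_of_unitriangular (fun i j => twoCol j i)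
    (fun i => by
      rw [twoCol_eq, ← two_mul, Nat.choose_self]
      field_simp
      simp)
    (fun i j h => by rw [twoCol_eq, Nat.choose_eq_zero_of_lt (by omega), Nat.cast_zero,
      mul_zero])] at h1
  rw [hC]
  have e1 : ∀ i : Fin (n + 1), shiftRow a (n + 1) i = a + i := fun i => if_pos i.2
  simp only [e1]
  rw [Fin.prod_univ_eq_prod_range (fun i => 2 * ((a + i : ℕ) : ℚ) + 1),
    Fin.prod_prod_Ioi _ fun i j => ((a + j : ℕ) : ℚ) * ((a + j : ℕ) + 1) -
      (a + i : ℕ) * ((a + i : ℕ) + 1)]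
  rw [Fin.prod_univ_eq_prod_range (fun i => 2 * (i : ℚ) + 1),
    Fin.prod_prod_Ioi _ fun i j => (j : ℚ) * (j + 1) - i * (i + 1)] at h1
  have key : (∏ i ∈ range (n + 1), (2 * ((a + i : ℕ) : ℚ) + 1)) *
      ∏ j ∈ range (n + 1), ∏ i ∈ range j,
      (((a + j : ℕ) : ℚ) * ((a + j : ℕ) + 1) - (a + i : ℕ) * ((a + i : ℕ) + 1)) =
      (∏ j ∈ range (n + 1), ∏ i ∈ range (j + 1), ((2 * a + 1 + i + j : ℚ) / (1 + i + j))) *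
        ((∏ i ∈ range (n + 1), (2 * (i : ℚ) + 1)) * ∏ j ∈ range (n + 1), ∏ i ∈ range j,
          ((j : ℚ) * (j + 1) - i * (i + 1))) := by
    simp only [← prod_mul_distrib]
    refine prod_congr rfl fun j _ => ?_
    rw [prod_range_succ]
    have : ∏ i ∈ range j, (((a + j : ℕ) : ℚ) * ((a + j : ℕ) + 1) -
          (a + i : ℕ) * ((a + i : ℕ) + 1)) =
        (∏ i ∈ range j, ((2 * a + 1 + i + j : ℚ) / (1 + i + j))) *
          ∏ i ∈ range j, ((j : ℚ) * (j + 1) - i * (i + 1)) := by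
      rw [← prod_mul_distrib]
      refine prod_congr rfl fun i _ => ?_
      push_cast
      field_simp
      ring
    rw [this]
    push_cast
    have h2 : (1 + j + j : ℚ) ≠ 0 := by positivity
    field_simp
    ring
  rw [mul_assoc, key]
  linear_combination -(∏ j ∈ range (n + 1), ∏ i ∈ range (j + 1),
    ((2 * a + 1 + i + j : ℚ) / (1 + i + j))) * h1

/-- The row `0, …, b - 1, m + b, …, m + 2 * b - 1`. -/
def gapRow (m b i : ℕ) : ℕ := if i < b then i else if i < 2 * b then m + i else 0

/-- Differences inside either block agree with those of `0, …, 2 * b - 1`, so only pairs from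
different blocks matter. Reversing the lower block by `i ↦ b - 1 - i` gives them the form `m + 1 + i
+ j`. -/
theorem card_chains_triPre_gapRow (m b : ℕ) :
    ((chains triPre (2 * b) (gapRow m b)).card : ℚ) =
      ∏ j ∈ range b, ∏ i ∈ range b, ((m + 1 + i + j : ℚ) / (1 + i + j)) := by
  rw [sum_chains_triPre _ _ fun i hi => by
    rw [gapRow, gapRow]
    split_ifs <;> omega]
  obtain ⟨C, hC⟩ := det_choose (n := 2 * b)
  have h1 := hC fun i => i
  rw [Matrix.det_eq_one_of_unitriangular (fun i j => (i.choose j : ℚ)) (by simp)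
    (fun i j h => by rw [Nat.choose_eq_zero_of_lt h, Nat.cast_zero])] at h1
  rw [hC, Fin.prod_prod_Ioi _ fun i j => (gapRow m b j : ℚ) - gapRow m b i]
  rw [Fin.prod_prod_Ioi _ fun i j => (j : ℚ) - i] at h1
  have key : ∏ j ∈ range (2 * b), ∏ i ∈ range j, ((gapRow m b j : ℚ) - gapRow m b i) =
      (∏ j ∈ range b, ∏ i ∈ range b, ((m + 1 + i + j : ℚ) / (1 + i + j))) *
        ∏ j ∈ range (2 * b), ∏ i ∈ range j, ((j : ℚ) - i) := by
    rw [two_mul, prod_range_add, prod_range_add, mul_left_comm]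
    congr 1
    · refine prod_congr rfl fun j hj => prod_congr rfl fun i hi => ?_
      rw [mem_range] at hi hj
      rw [gapRow, gapRow, if_pos hj, if_pos (hi.trans hj)]
    · rw [← prod_mul_distrib]
      refine prod_congr rfl fun j hj => ?_
      rw [mem_range] at hj
      rw [prod_range_add, prod_range_add, ← mul_assoc,
        ← prod_range_reflect (fun i : ℕ => (m + 1 + i + j : ℚ) / (1 + i + j)) b,
        ← prod_mul_distrib]
      congr 1
      · refine prod_congr rfl fun i hi => ?_
        rw [mem_range] at hi
        rw [gapRow, gapRow, if_neg (by omega), if_pos (by omega), if_pos (by omega)]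
        have e1 : ((b - 1 - i : ℕ) : ℚ) = b - 1 - i := by
          rw [Nat.cast_sub (by omega), Nat.cast_sub (by omega), Nat.cast_one]
        have e2 : (1 + (b - 1 - i) + j : ℚ) ≠ 0 := by
          rw [← e1]
          positivity
        simp only [e1]
        push_cast
        field_simp
        ring
      · refine prod_congr rfl fun i hi => ?_
        rw [mem_range] at hi
        rw [gapRow, gapRow, if_neg (by omega), if_pos (by omega), if_neg (by omega),
          if_pos (by omega)]
        push_cast
        ring
  rw [key]
  linear_combination -(∏ j ∈ range b, ∏ i ∈ range b, ((m + 1 + i + j : ℚ) / (1 + i + j))) * h1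

/-! ### Identities between products over squares and triangles. -/

/-- The factor depends on `i + j` only, so the square splits at its diagonal into a closed triangle
and a reflected open one; the latter is reindexed by `j ↦ j + 1`. -/
theorem prod_square_eq_prod_triangle_mul (G : ℕ → ℚ) (n : ℕ) :
    ∏ j ∈ range (n + 1), ∏ i ∈ range (n + 1), G (i + j) =
      (∏ j ∈ range n, ∏ i ∈ range (j + 1), G (i + j + 1)) *
        ∏ j ∈ range (n + 1), ∏ i ∈ range (j + 1), G (i + j) := by
  induction n with
  | zero => simp
  | succ n ih =>
    have h1 : ∏ j ∈ range (n + 2), ∏ i ∈ range (n + 2), G (i + j) =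
        (∏ j ∈ range (n + 1), ∏ i ∈ range (n + 1), G (i + j)) *
          (∏ j ∈ range (n + 1), G (n + 1 + j)) * ∏ i ∈ range (n + 2), G (i + (n + 1)) := by
      rw [prod_range_succ, ← prod_mul_distrib]
      congr 1
      exact prod_congr rfl fun j _ => prod_range_succ _ _
    rw [h1, ih]
    have h2 : ∏ j ∈ range (n + 1), G (n + 1 + j) = ∏ i ∈ range (n + 1), G (i + n + 1) :=
      prod_congr rfl fun j _ => by congr 1; ring
    rw [h2, prod_range_succ (fun j => ∏ i ∈ range (j + 1), G (i + j + 1)) n,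
      prod_range_succ (fun j => ∏ i ∈ range (j + 1), G (i + j)) (n + 1)]
    ring

theorem prod_square_eq_two_mul_prod_triangle_mul (a : ℚ) (n : ℕ) :
    ∏ j ∈ range (n + 1), ∏ i ∈ range (n + 1), ((2 * a + 2 + i + j : ℚ) / (1 + i + j)) =
      2 * (∏ j ∈ range (n + 1), ∏ i ∈ range (j + 1), ((2 * a + 2 + i + j : ℚ) / (2 + i + j))) *
        ∏ j ∈ range n, ∏ i ∈ range (j + 1), ((2 * a + 3 + i + j : ℚ) / (1 + i + j)) := by
  induction n with
  | zero =>
    simp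
    ring
  | succ n ih =>
    have h1 : ∏ j ∈ range (n + 2), ∏ i ∈ range (n + 2), ((2 * a + 2 + i + j : ℚ) / (1 + i + j)) =
        (∏ j ∈ range (n + 1), ∏ i ∈ range (n + 1), ((2 * a + 2 + i + j : ℚ) / (1 + i + j))) *
          (∏ j ∈ range (n + 1), ((2 * a + 2 + (n + 1 : ℕ) + j : ℚ) / (1 + (n + 1 : ℕ) + j))) *
            ∏ i ∈ range (n + 2), ((2 * a + 2 + i + (n + 1 : ℕ) : ℚ) / (1 + i + (n + 1 : ℕ))) := by
      rw [prod_range_succ, ← prod_mul_distrib]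
      congr 1
      exact prod_congr rfl fun j _ => prod_range_succ _ _
    rw [h1, ih, prod_range_succ _ (n + 1),
      prod_range_succ (fun j => ∏ i ∈ range (j + 1), ((2 * a + 2 + i + j : ℚ) / (2 + i + j))) (n + 1),
      prod_range_succ (fun j => ∏ i ∈ range (j + 1), ((2 * a + 3 + i + j : ℚ) / (1 + i + j))) n,
      prod_range_succ _ (n + 1)]
    -- This compares the borders added when `n` grows, apart from the corner factors. The numerators
    -- agree on both sides.
    have h2 : (∏ j ∈ range (n + 1), ((2 * a + 2 + (n + 1 : ℕ) + j : ℚ) / (1 + (n + 1 : ℕ) + j))) *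
        (∏ i ∈ range (n + 1), ((2 * a + 2 + i + (n + 1 : ℕ) : ℚ) / (1 + i + (n + 1 : ℕ)))) *
        (2 * n + 4) =
        (∏ i ∈ range (n + 1), ((2 * a + 2 + i + (n + 1 : ℕ) : ℚ) / (2 + i + (n + 1 : ℕ)))) *
        (∏ i ∈ range (n + 1), ((2 * a + 3 + i + n : ℚ) / (1 + i + n))) * (2 * n + 3) := by
      -- With a free length `k` the denominators `(n + 2 + i) ^ 2` and `(n + 3 + i) * (n + 1 + i)`
      -- telescope. At `k = n + 1` a common factor `n + 1` remains and is cancelled.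
      have h3 : ∀ k : ℕ, (∏ j ∈ range k, ((2 * a + 2 + (n + 1 : ℕ) + j : ℚ) / (1 + (n + 1 : ℕ) + j))) *
        (∏ i ∈ range k, ((2 * a + 2 + i + (n + 1 : ℕ) : ℚ) / (1 + i + (n + 1 : ℕ)))) *
        ((n + 1 + k) * (n + 2)) =
        (∏ i ∈ range k, ((2 * a + 2 + i + (n + 1 : ℕ) : ℚ) / (2 + i + (n + 1 : ℕ)))) *
        (∏ i ∈ range k, ((2 * a + 3 + i + n : ℚ) / (1 + i + n))) * ((n + 2 + k) * (n + 1)) := by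
        intro k
        induction k with
        | zero =>
          simp
          ring
        | succ k ih =>
          simp only [prod_range_succ]
          push_cast at ih ⊢
          set A := ∏ j ∈ range k, ((2 * a + 2 + (n + 1) + j : ℚ) / (1 + (n + 1) + j))
          set B := ∏ i ∈ range k, ((2 * a + 2 + i + (n + 1) : ℚ) / (1 + i + (n + 1)))
          set C := ∏ i ∈ range k, ((2 * a + 2 + i + (n + 1) : ℚ) / (2 + i + (n + 1)))
          set D := ∏ i ∈ range k, ((2 * a + 3 + i + n : ℚ) / (1 + i + n))
          have p1 : (1 + (n + 1) + k : ℚ) ≠ 0 := by positivity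
          have p2 : (1 + k + (n + 1) : ℚ) ≠ 0 := by positivity
          have p3 : (2 + k + (n + 1) : ℚ) ≠ 0 := by positivity
          have p4 : (1 + k + n : ℚ) ≠ 0 := by positivity
          field_simp
          linear_combination (2 * a + 3 + k + n) ^ 2 * (n + 3 + k) * (n + 2 + k) * ih
      have h4 := h3 (n + 1)
      have p : (n + 1 : ℚ) ≠ 0 := by positivity
      apply mul_right_cancel₀ p
      push_cast at h4 ⊢
      linear_combination h4
    push_cast at h2 ⊢
    have p1 : (1 + (n + 1) + (n + 1) : ℚ) ≠ 0 := by positivity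
    have p2 : (2 + (n + 1) + (n + 1) : ℚ) ≠ 0 := by positivity
    set X := ∏ j ∈ range (n + 1), ∏ i ∈ range (j + 1), ((2 * a + 2 + i + j : ℚ) / (2 + i + j))
    set Y := ∏ j ∈ range n, ∏ i ∈ range (j + 1), ((2 * a + 3 + i + j : ℚ) / (1 + i + j))
    set A := ∏ j ∈ range (n + 1), ((2 * a + 2 + (n + 1) + j : ℚ) / (1 + (n + 1) + j))
    set B := ∏ i ∈ range (n + 1), ((2 * a + 2 + i + (n + 1) : ℚ) / (1 + i + (n + 1)))
    set C := ∏ i ∈ range (n + 1), ((2 * a + 2 + i + (n + 1) : ℚ) / (2 + i + (n + 1)))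
    set D := ∏ i ∈ range (n + 1), ((2 * a + 3 + i + n : ℚ) / (1 + i + n))
    field_simp
    linear_combination X * Y * (2 * a + 2 + (n + 1) + (n + 1)) * h2

/-- The binomial coefficient collects the diagonal factors `(a + j + 1) / (j + 1)`; the rest of the
triangle is reindexed by `j ↦ j + 1`. -/
theorem prod_triangle_eq_choose_mul (a n : ℕ) :
    ∏ j ∈ range n, ∏ i ∈ range (j + 1), ((2 * a + 2 + i + j : ℚ) / (2 + i + j)) =
      (a + n).choose n * ∏ j ∈ range (n - 1), ∏ i ∈ range (j + 1),
        ((2 * a + 3 + i + j : ℚ) / (3 + i + j)) := by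
  rcases n with _ | n
  · simp
  induction n with
  | zero =>
    simp
    field_simp
  | succ n ih =>
    rw [prod_range_succ, ih, Nat.add_sub_cancel, Nat.add_sub_cancel, prod_range_succ _ n,
      prod_range_succ _ (n + 1)]
    have h := Nat.add_one_mul_choose_eq (a + (n + 1)) (n + 1)
    have h' : ((a + (n + 1) + 1 : ℕ) * (a + (n + 1)).choose (n + 1) : ℚ) =
      (a + (n + 1 + 1)).choose (n + 1 + 1) * (n + 1 + 1 : ℕ) := by exact_mod_cast h
    have h2 : ∏ i ∈ range (n + 1), ((2 * a + 2 + i + (n + 1 : ℕ) : ℚ) / (2 + i + (n + 1 : ℕ))) =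
        ∏ i ∈ range (n + 1), ((2 * a + 3 + i + n : ℚ) / (3 + i + n)) :=
      prod_congr rfl fun i _ => by
        push_cast
        congr 1 <;> ring
    rw [h2]
    push_cast at h' ⊢
    set X := ∏ i ∈ range (n + 1), ((2 * a + 3 + i + n : ℚ) / (3 + i + n))
    set Y := ∏ j ∈ range n, ∏ i ∈ range (j + 1), ((2 * a + 3 + i + j : ℚ) / (3 + i + j))
    have p1 : (2 + (n + 1) + (n + 1) : ℚ) ≠ 0 := by positivity
    field_simp
    linear_combination 2 * X * Y * h'

theorem prod_Icc_prod_Icc (n : ℕ) (f : ℕ → ℕ → ℚ) :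
    ∏ i ∈ Icc 1 n, ∏ j ∈ Icc i n, f i j = ∏ j ∈ range n, ∏ i ∈ range (j + 1), f (i + 1) (j + 1) := by
  have h : ∀ (k : ℕ) (g : ℕ → ℚ), ∏ i ∈ Icc 1 k, g i = ∏ i ∈ range k, g (i + 1) := by
    intro k g
    rw [range_eq_Ico, prod_Ico_add' g 0 k 1]
    rfl
  rw [prod_comm' (t' := Icc 1 n) (s' := fun j => Icc 1 j)
    (by intro i j; simp only [mem_Icc]; omega), h]
  exact prod_congr rfl fun j _ => h _ _

/-! ### Plane partitions as height functions and as triangular arrays. -/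

namespace PlanePartition

variable {m b : ℕ}

/-- Membership of the cube with natural coordinates `i, j, k`. -/
def HasCube (π : PlanePartition m b b) (i j k : ℕ) : Prop :=
  ∃ (hi : i < m) (hj : j < b) (hk : k < b), (⟨i, hi⟩, ⟨j, hj⟩, ⟨k, hk⟩) ∈ π

theorem HasCube.mono {π : PlanePartition m b b} {i j k i' j' k' : ℕ} (h : π.HasCube i j k)
    (hi : i' ≤ i) (hj : j' ≤ j) (hk : k' ≤ k) : π.HasCube i' j' k' := by
  obtain ⟨h1, h2, h3, h⟩ := h
  exact ⟨by omega, by omega, by omega, π.lower (by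
    simp only [Prod.le_def, Fin.mk_le_mk]
    exact ⟨hi, hj, hk⟩) h⟩

theorem exists_not_hasCube (π : PlanePartition m b b) (j k : ℕ) : ∃ i, ¬ π.HasCube i j k :=
  ⟨m, fun h => lt_irrefl _ h.1⟩

open Classical in
/-- The number of cubes in the column over `(j, k)`. -/
noncomputable def height (π : PlanePartition m b b) (j k : ℕ) : ℕ :=
  Nat.find (π.exists_not_hasCube j k)

theorem lt_height {π : PlanePartition m b b} {i j k : ℕ} : i < π.height j k ↔ π.HasCube i j k := by
  classical
  rw [height, Nat.lt_find_iff]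
  constructor
  · intro h
    exact not_not.1 (h i le_rfl)
  · intro h l hl
    exact not_not.2 (h.mono hl le_rfl le_rfl)

end PlanePartition

/-- The height functions of the plane partitions in an `m × b × b` box. -/
def heightFns (m b : ℕ) : Set (ℕ → ℕ → ℕ) :=
  {h | (∀ j k, h j k ≤ m) ∧ (∀ j k j' k', j ≤ j' → k ≤ k' → h j' k' ≤ h j k) ∧
    ∀ j k, b ≤ j ∨ b ≤ k → h j k = 0}

/-- A plane partition is given by its height function. -/
noncomputable def PlanePartition.equivHeightFns (m b : ℕ) :
    PlanePartition m b b ≃ heightFns m b where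
  toFun π := ⟨π.height, by
    refine ⟨fun j k => ?_, fun j k j' k' hj hk => ?_, fun j k h => ?_⟩
    · by_contra! h
      exact lt_irrefl _ (PlanePartition.lt_height.1 h).1
    · by_contra! h
      exact lt_irrefl _ (PlanePartition.lt_height.2
        ((PlanePartition.lt_height.1 h).mono le_rfl hj hk))
    · by_contra! h'
      obtain ⟨-, h1, h2, -⟩ := PlanePartition.lt_height.1 (Nat.pos_of_ne_zero h')
      omega⟩
  invFun h :=
    { carrier := {x | (x.1 : ℕ) < h.1 x.2.1 x.2.2}
      lower' := by
        rintro ⟨i, j, k⟩ ⟨i', j', k'⟩ hle hx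
        simp only [Prod.le_def] at hle
        have := h.2.2.1 j' k' j k hle.2.1 hle.2.2
        have h1 : (i' : ℕ) ≤ i := hle.1
        simp only [Set.mem_ofPred_eq] at hx ⊢
        omega }
  left_inv π := by
    ext ⟨i, j, k⟩
    change (i : ℕ) < π.height j k ↔ _
    rw [PlanePartition.lt_height]
    exact ⟨fun h => h.2.2.2, fun h => ⟨i.2, j.2, k.2, h⟩⟩
  right_inv h := by
    apply Subtype.ext
    ext j k
    refine eq_of_forall_lt_iff fun i => ?_
    rw [PlanePartition.lt_height]
    constructor
    · rintro ⟨_, _, _, h'⟩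
      exact h'
    · intro h'
      have h1 : h.1 j k ≠ 0 := by omega
      have h2 := h.2.1 j k
      have h3 := mt (h.2.2.2 j k) h1
      exact ⟨by omega, by omega, by omega, h'⟩

/-- Each column is an initial segment, so comparing memberships at `i` and `m - 1 - i` for all `i`
says that the two column lengths add up to `m`. -/
theorem PlanePartition.isTransposeComplement_iff {m b : ℕ} (π : PlanePartition m b b) :
    π.IsTransposeComplement ↔
      ∀ j k, j < b → k < b → π.height j k + π.height (b - 1 - k) (b - 1 - j) = m := by
  have hle : ∀ j k, π.height j k ≤ m := (PlanePartition.equivHeightFns m b π).2.1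
  have hmem : ∀ (i : Fin m) (j k : Fin b), (i, j, k) ∈ π ↔ (i : ℕ) < π.height j k := by
    intro i j k
    rw [PlanePartition.lt_height]
    exact ⟨fun h => ⟨i.2, j.2, k.2, h⟩, fun h => h.2.2.2⟩
  have hrev : ∀ k : Fin b, (k.rev : ℕ) = b - 1 - k := fun k => by
    rw [Fin.val_rev]
    omega
  constructor
  · intro h j k hj hk
    have key : ∀ i < m, i < π.height j k ↔ ¬ m - 1 - i < π.height (b - 1 - k) (b - 1 - j) := by
      intro i hi
      have := h ⟨i, hi⟩ ⟨j, hj⟩ ⟨k, hk⟩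
      rw [hmem, hmem, hrev, hrev, Fin.val_rev, show m - (i + 1) = m - 1 - i by omega] at this
      exact this
    have h1 := hle j k
    have h2 := hle (b - 1 - k) (b - 1 - j)
    by_contra hne
    rcases lt_or_gt_of_ne hne with hlt | hlt
    · have := key (π.height j k) (by omega)
      omega
    · have := key (π.height j k - 1) (by omega)
      omega
  · intro h i j k
    have := h j k j.2 k.2
    rw [hmem, hmem, hrev, hrev, Fin.val_rev]
    have := i.2
    omega

/-- Interlacing iterated in its two directions; for the array of heights these are the two
monotonicities, and followed up to the last row they bound every entry. -/
theorem triPre_chain_le {n : ℕ} {s : ℕ → ℕ} {c : ℕ → ℕ → ℕ} (hc : c ∈ chains triPre n s) (k : ℕ) :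
    ∀ {r i : ℕ}, r + k ≤ n → i < r → c (r + k) i ≤ c r i ∧ c r i + k ≤ c (r + k) (i + k) := by
  induction k with
  | zero => intro r i _ _; simp
  | succ k ih =>
    intro r i hr hi
    have h1 := ih (r := r) (i := i) (by omega) hi
    have h2 := (mem_chains.1 hc).2.1 (r + k) (by omega)
    have h3 := (mem_boxFns.1 h2).1 i (by omega)
    have h4 := (mem_boxFns.1 h2).1 (i + k) (by omega)
    rw [mem_Ico] at h3 h4
    rw [← add_assoc, ← add_assoc i]
    omega

/-- The plane partitions in an `m × b × b` box as triangular arrays with a fixed last row. -/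
noncomputable def heightFnsEquivChains (m b : ℕ) :
    heightFns m b ≃ {c // c ∈ chains triPre (2 * b) (gapRow m b)} where
  -- Row `r` reads a diagonal of the height array, where the difference of the coordinates is `r -
  -- b`. Outside the box it continues with `0` on one side and `m` on the other, and adding `i`
  -- makes the row strictly increasing.
  toFun h := ⟨fun r i => if r ≤ 2 * b ∧ i < r then
      (if b ≤ i then m else h.1 (r - 1 - i) (b - 1 - i)) + i else 0, by
    obtain ⟨h, h1, h2, h3⟩ := h
    rw [mem_chains]
    refine ⟨?_, fun r hr => mem_boxFns.2 ⟨fun i hi => ?_, fun i hi => ?_⟩, fun r hr => ?_⟩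
    · ext i
      rw [gapRow]
      have := h3 (2 * b - 1 - i) (b - 1 - i)
      dsimp only
      split_ifs <;> omega
    · rw [mem_Ico]
      have e1 := h2 (r - 1 - i) (b - 1 - i) (r - i) (b - 1 - i) (by omega) le_rfl
      have e2 := h2 (r - 1 - i) (b - 1 - (i + 1)) (r - 1 - i) (b - 1 - i) le_rfl (by omega)
      have e3 := h1 (r - 1 - i) (b - 1 - i)
      dsimp only
      rw [if_pos (c := r + 1 ≤ 2 * b ∧ i < r + 1) (by omega),
        if_pos (c := r ≤ 2 * b ∧ i < r) (by omega),
        if_pos (c := r + 1 ≤ 2 * b ∧ i + 1 < r + 1) (by omega),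
        show r + 1 - 1 - i = r - i by omega, show r + 1 - 1 - (i + 1) = r - 1 - i by omega]
      split_ifs <;> omega
    · dsimp only
      rw [if_neg (by omega)]
    · ext i
      dsimp only
      rw [if_neg (by omega)]
      rfl⟩
  invFun c := ⟨fun p k => if p < b ∧ k < b then c.1 (p + (b - 1 - k) + 1) (b - 1 - k) - (b - 1 - k)
      else 0, by
    obtain ⟨c, hc⟩ := c
    have htop : ∀ i, c (2 * b) i = gapRow m b i := fun i => by rw [(mem_chains.1 hc).1]
    refine ⟨fun p k => ?_, fun p k p' k' hp hk => ?_, fun p k h => ?_⟩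
    · dsimp only
      split_ifs with h
      · have := (triPre_chain_le hc (2 * b - (p + (b - 1 - k) + 1)) (r := p + (b - 1 - k) + 1)
          (i := b - 1 - k) (by omega) (by omega)).2
        rw [show p + (b - 1 - k) + 1 + (2 * b - (p + (b - 1 - k) + 1)) = 2 * b by omega, htop,
          gapRow] at this
        split_ifs at this <;> omega
      · omega
    · dsimp only
      split_ifs with h h'
      · have e1 := (triPre_chain_le hc (p' - p) (r := p + (b - 1 - k') + 1)
          (i := b - 1 - k') (by omega) (by omega)).1
        have e2 := (triPre_chain_le hc (k' - k) (r := p + (b - 1 - k') + 1)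
          (i := b - 1 - k') (by omega) (by omega)).2
        rw [show p + (b - 1 - k') + 1 + (p' - p) = p' + (b - 1 - k') + 1 by omega] at e1
        rw [show p + (b - 1 - k') + 1 + (k' - k) = p + (b - 1 - k) + 1 by omega,
          show b - 1 - k' + (k' - k) = b - 1 - k by omega] at e2
        omega
      all_goals omega
    · dsimp only
      rw [if_neg (by omega)]⟩
  left_inv h := by
    obtain ⟨h, h1, h2, h3⟩ := h
    apply Subtype.ext
    ext p k
    dsimp only
    split_ifs with h4 h5 h6
    · omega
    · rw [Nat.add_sub_cancel]
      congr 1 <;> omega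
    · omega
    · exact (h3 p k (by omega)).symm
  right_inv c := by
    obtain ⟨c, hc⟩ := c
    have htop : ∀ i, c (2 * b) i = gapRow m b i := fun i => by rw [(mem_chains.1 hc).1]
    apply Subtype.ext
    ext r i
    dsimp only
    by_cases h1 : r ≤ 2 * b ∧ i < r
    · rw [if_pos h1]
      have e := triPre_chain_le hc (2 * b - r) (r := r) (i := i) (by omega) h1.2
      rw [show r + (2 * b - r) = 2 * b by omega, htop, htop, gapRow, gapRow] at e
      by_cases h2 : b ≤ i
      · rw [if_pos h2]
        split_ifs at e <;> omega
      · rw [if_neg h2]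
        by_cases h3 : r - 1 - i < b ∧ b - 1 - i < b
        · rw [if_pos h3, show r - 1 - i + (b - 1 - (b - 1 - i)) + 1 = r by omega,
            show b - 1 - (b - 1 - i) = i by omega]
          split_ifs at e <;> omega
        · rw [if_neg h3]
          split_ifs at e <;> omega
    · rw [if_neg h1]
      by_cases h2 : r ≤ 2 * b
      · rcases Nat.lt_or_ge r (2 * b) with h3 | h3
        · exact ((mem_boxFns.1 ((mem_chains.1 hc).2.1 r h3)).2 i (by omega)).symm
        · rw [show r = 2 * b by omega, htop, gapRow, if_neg (by omega), if_neg (by omega)]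
      · rw [(mem_chains.1 hc).2.2 r (by omega)]
        rfl

theorem numPP_eq (m b : ℕ) :
    (numPP m b b : ℚ) = ∏ j ∈ range b, ∏ i ∈ range b, ((m + 1 + i + j : ℚ) / (1 + i + j)) := by
  rw [← card_chains_triPre_gapRow, numPP,
    Nat.card_congr ((PlanePartition.equivHeightFns m b).trans (heightFnsEquivChains m b))]
  simp

/-! ### Half triangles, staircase partitions and TCPPs. -/

section StairChain

variable {n : ℕ} {s : ℕ → ℕ} {c : ℕ → ℕ → ℕ}

theorem stair_even (hc : c ∈ chains stairPre n s) {x i : ℕ} (hx : x < n) (h2 : x % 2 = 0)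
    (hi : i ≤ x / 2) : c x i ≤ c (x + 1) i := by
  have h := (mem_boxFns.1 ((mem_chains.1 hc).2.1 x hx)).1 i (by omega)
  rw [if_pos h2] at h
  split_ifs at h with h0
  · subst h0
    exact mem_Iic.1 h
  · exact (mem_Ioc.1 h).2

theorem stair_even_succ (hc : c ∈ chains stairPre n s) {x i : ℕ} (hx : x < n) (h2 : x % 2 = 0)
    (hi : i + 1 ≤ x / 2) : c (x + 1) i < c x (i + 1) := by
  have h := (mem_boxFns.1 ((mem_chains.1 hc).2.1 x hx)).1 (i + 1) (by omega)
  rw [if_pos h2, if_neg (by omega)] at h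
  exact (mem_Ioc.1 h).1

theorem stair_odd (hc : c ∈ chains stairPre n s) {x i : ℕ} (hx : x < n) (h2 : x % 2 = 1)
    (hi : i ≤ x / 2) : c (x + 1) i ≤ c x i ∧ c x i < c (x + 1) (i + 1) := by
  have h := (mem_boxFns.1 ((mem_chains.1 hc).2.1 x hx)).1 i (by omega)
  rw [if_neg (by omega)] at h
  exact mem_Ico.1 h

theorem stair_zero (hc : c ∈ chains stairPre n s) {x i : ℕ} (hx : x < n) (hi : x / 2 < i) :
    c x i = 0 :=
  (mem_boxFns.1 ((mem_chains.1 hc).2.1 x hx)).2 i hi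

/-- The array of weakly monotone parts that belongs to a chain of strictly increasing rows. -/
def stairPart (c : ℕ → ℕ → ℕ) (p q : ℕ) : ℤ := c (p + q) ((p + q) / 2 - p) - ((p + q) / 2 - p : ℕ)

theorem stairPart_right (hc : c ∈ chains stairPre n s) {p q : ℕ} (hpq : p ≤ q) (h : p + q < n) :
    stairPart c p q ≤ stairPart c p (q + 1) := by
  rw [stairPart, stairPart, ← add_assoc]
  rcases Nat.mod_two_eq_zero_or_one (p + q) with h2 | h2
  · have := stair_even hc h h2 (i := (p + q) / 2 - p) (by omega)
    rw [show (p + q + 1) / 2 = (p + q) / 2 by omega]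
    omega
  · have := (stair_odd hc h h2 (i := (p + q) / 2 - p) (by omega)).2
    rw [show (p + q + 1) / 2 - p = (p + q) / 2 - p + 1 by omega]
    omega

theorem stairPart_left (hc : c ∈ chains stairPre n s) {p q : ℕ} (hpq : p < q) (h : p + q < n) :
    stairPart c (p + 1) q ≤ stairPart c p q := by
  rw [stairPart, stairPart, add_right_comm]
  rcases Nat.mod_two_eq_zero_or_one (p + q) with h2 | h2
  · have := stair_even_succ hc h h2 (i := (p + q) / 2 - p - 1) (by omega)
    rw [show (p + q + 1) / 2 - (p + 1) = (p + q) / 2 - p - 1 by omega]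
    rw [show (p + q) / 2 - p - 1 + 1 = (p + q) / 2 - p by omega] at this
    omega
  · have := (stair_odd hc h h2 (i := (p + q) / 2 - p) (by omega)).1
    rw [show (p + q + 1) / 2 - (p + 1) = (p + q) / 2 - p by omega]
    omega

theorem stairPart_mono_right (hc : c ∈ chains stairPre n s) {p q : ℕ} (hpq : p ≤ q) (k : ℕ)
    (h : p + (q + k) ≤ n) : stairPart c p q ≤ stairPart c p (q + k) := by
  induction k with
  | zero => simp
  | succ k ih => exact (ih (by omega)).trans (stairPart_right hc (by omega) (by omega))

theorem stairPart_anti_left (hc : c ∈ chains stairPre n s) {p q : ℕ} (k : ℕ) (hpq : p + k ≤ q)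
    (h : p + k + q ≤ n) : stairPart c (p + k) q ≤ stairPart c p q := by
  induction k with
  | zero => simp
  | succ k ih =>
    rw [← add_assoc] at hpq h ⊢
    exact (stairPart_left hc (by omega) (by omega)).trans (ih (by omega) (by omega))

end StairChain

section StairShift

variable {a e : ℕ} {c : ℕ → ℕ → ℕ}

theorem stairPart_top (hc : c ∈ chains stairPre (2 * e + 1) (shiftRow a (e + 1))) {p : ℕ}
    (hp : p ≤ e) : stairPart c p (2 * e + 1 - p) = a := by
  rw [stairPart, show p + (2 * e + 1 - p) = 2 * e + 1 by omega, (mem_chains.1 hc).1, shiftRow,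
    if_pos (by omega)]
  omega

theorem stairPart_le (hc : c ∈ chains stairPre (2 * e + 1) (shiftRow a (e + 1))) {p q : ℕ}
    (hpq : p ≤ q) (h : p + q ≤ 2 * e + 1) : stairPart c p q ≤ a := by
  have := stairPart_mono_right hc hpq (2 * e + 1 - p - q) (by omega)
  rwa [show q + (2 * e + 1 - p - q) = 2 * e + 1 - p by omega, stairPart_top hc (by omega)] at this

/-- For `q > e` the cell `(2 * e + 1 - q, q)` lies on the last row, where the part is `a`.
Decreasing the first coordinate cannot lower the part, so this region is frozen. -/
theorem stairPart_of_lt (hc : c ∈ chains stairPre (2 * e + 1) (shiftRow a (e + 1))) {p q : ℕ}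
    (hq : e < q) (h : p + q ≤ 2 * e + 1) : stairPart c p q = a := by
  refine le_antisymm (stairPart_le hc (by omega) h) ?_
  have := stairPart_anti_left hc (p := p) (q := q) (2 * e + 1 - q - p) (by omega) (by omega)
  have h1 := stairPart_top hc (p := 2 * e + 1 - q) (by omega)
  rw [show 2 * e + 1 - (2 * e + 1 - q) = q by omega] at h1
  rwa [show p + (2 * e + 1 - q - p) = 2 * e + 1 - q by omega, h1] at this

/-- For `q ≤ e` the part is at least the one at `(q, q)`, which is the first entry of a row, with
nothing subtracted. -/
theorem stairPart_nonneg (hc : c ∈ chains stairPre (2 * e + 1) (shiftRow a (e + 1))) {p q : ℕ}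
    (hpq : p ≤ q) (h : p + q ≤ 2 * e + 1) : 0 ≤ stairPart c p q := by
  rcases Nat.lt_or_ge e q with hq | hq
  · rw [stairPart_of_lt hc hq h]
    positivity
  · refine le_trans ?_ (stairPart_anti_left hc (p := p) (q := q) (q - p) (by omega) (by omega))
    rw [stairPart]
    omega

theorem cast_stair_eq {x i : ℕ} (hi : i ≤ x / 2) :
    (c x i : ℤ) = stairPart c (x / 2 - i) ((x + 1) / 2 + i) + i := by
  rw [stairPart, show x / 2 - i + ((x + 1) / 2 + i) = x by omega,
    show x / 2 - (x / 2 - i) = i by omega]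
  ring

end StairShift

/-- The functions on pairs of natural numbers that are antitone, at most `a`, and supported on
`j + k < n`: plane partitions of staircase shape with parts at most `a`. -/
def stairFns (a n : ℕ) : Set (ℕ → ℕ → ℕ) :=
  {g | (∀ j k, g j k ≤ a) ∧ (∀ j k j' k', j ≤ j' → k ≤ k' → g j' k' ≤ g j k) ∧
    ∀ j k, n ≤ j + k → g j k = 0}

/-- Plane partitions of staircase shape as chains of interlacing rows. -/
noncomputable def stairFnsEquivChains (a e : ℕ) :
    stairFns a (e + 1) ≃ {c // c ∈ chains stairPre (2 * e + 1) (shiftRow a (e + 1))} where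
  -- Entry `i` of row `x` has coordinates `p = x / 2 - i` and `q = (x + 1) / 2 + i`, and the cell of
  -- `g` is `(p, e - q)`. For `q > e` the truncated subtraction would be wrong, and the frozen value
  -- `a` is used.
  toFun g := ⟨fun x i => if x ≤ 2 * e + 1 ∧ i ≤ x / 2 then
      (if e < (x + 1) / 2 + i then a else g.1 (x / 2 - i) (e - ((x + 1) / 2 + i))) + i else 0, by
    obtain ⟨g, h1, h2, h3⟩ := g
    rw [mem_chains]
    refine ⟨?_, fun x hx => mem_boxFns.2 ⟨fun i hi => ?_, fun i hi => ?_⟩, fun x hx => ?_⟩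
    · ext i
      rw [shiftRow]
      dsimp only
      split_ifs <;> omega
    · rcases Nat.mod_two_eq_zero_or_one x with hm | hm
      · have e1 := h1 (x / 2 - i) (e - (x / 2 + i))
        have e2 := h2 (x / 2 - i) (e - (x / 2 + i + 1)) (x / 2 - i) (e - (x / 2 + i)) le_rfl
          (by omega)
        have e3 := h2 (x / 2 - i) (e - (x / 2 + i)) (x / 2 - i + 1) (e - (x / 2 + i))
          (by omega) le_rfl
        have p1 : (if e < x / 2 + i then a else g (x / 2 - i) (e - (x / 2 + i))) ≤
            if e < x / 2 + i + 1 then a else g (x / 2 - i) (e - (x / 2 + i + 1)) := by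
          split_ifs <;> omega
        rw [if_pos hm]
        have d1 : (x + 1) / 2 = x / 2 := by omega
        have d2 : (x + 1 + 1) / 2 = x / 2 + 1 := by omega
        by_cases hi0 : i = 0
        · subst hi0
          rw [if_pos rfl, mem_Iic]
          dsimp only
          rw [if_pos (c := x ≤ 2 * e + 1 ∧ 0 ≤ x / 2) (by omega),
            if_pos (c := x + 1 ≤ 2 * e + 1 ∧ 0 ≤ (x + 1) / 2) (by omega), d1, d2,
            show x / 2 + 1 + 0 = x / 2 + 0 + 1 by omega]
          omega
        · obtain ⟨l, rfl⟩ : ∃ l, i = l + 1 := ⟨i - 1, by omega⟩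
          rw [if_neg hi0, mem_Ioc]
          dsimp only
          rw [if_pos (c := x ≤ 2 * e + 1 ∧ l + 1 ≤ x / 2) (by omega),
            if_pos (c := x + 1 ≤ 2 * e + 1 ∧ l + 1 ≤ (x + 1) / 2) (by omega),
            if_pos (c := x + 1 ≤ 2 * e + 1 ∧ l + 1 - 1 ≤ (x + 1) / 2) (by omega), d1, d2,
            show x / 2 + 1 + (l + 1) = x / 2 + (l + 1) + 1 by omega,
            show x / 2 + 1 + (l + 1 - 1) = x / 2 + (l + 1) by omega,
            show x / 2 - (l + 1 - 1) = x / 2 - (l + 1) + 1 by omega]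
          refine ⟨?_, by omega⟩
          split_ifs <;> omega
      · have d1 : (x + 1) / 2 = x / 2 + 1 := by omega
        have d2 : (x + 1 + 1) / 2 = x / 2 + 1 := by omega
        have e1 := h1 (x / 2 - i) (e - (x / 2 + 1 + i))
        have e2 := h2 (x / 2 - i) (e - (x / 2 + 1 + i + 1)) (x / 2 - i) (e - (x / 2 + 1 + i)) le_rfl
          (by omega)
        have e3 := h2 (x / 2 - i) (e - (x / 2 + 1 + i)) (x / 2 - i + 1) (e - (x / 2 + 1 + i))
          (by omega) le_rfl
        rw [if_neg (by omega), mem_Ico]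
        dsimp only
        rw [if_pos (c := x ≤ 2 * e + 1 ∧ i ≤ x / 2) (by omega),
          if_pos (c := x + 1 ≤ 2 * e + 1 ∧ i ≤ (x + 1) / 2) (by omega),
          if_pos (c := x + 1 ≤ 2 * e + 1 ∧ i + 1 ≤ (x + 1) / 2) (by omega), d2, d1,
          show x / 2 + 1 + (i + 1) = x / 2 + 1 + i + 1 by omega,
          show x / 2 + 1 - (i + 1) = x / 2 - i by omega,
          show x / 2 + 1 - i = x / 2 - i + 1 by omega]
        split_ifs <;> omega
    · dsimp only
      rw [if_neg (by omega)]
    · ext i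
      dsimp only
      rw [if_neg (by omega)]
      rfl⟩
  invFun c := ⟨fun p k => if p + k ≤ e then (stairPart c.1 p (e - k)).toNat else 0, by
    obtain ⟨c, hc⟩ := c
    refine ⟨fun p k => ?_, fun p k p' k' hp hk => ?_, fun p k h => ?_⟩
    · dsimp only
      split_ifs with h
      · have := stairPart_le hc (p := p) (q := e - k) (by omega) (by omega)
        omega
      · omega
    · dsimp only
      split_ifs with h h'
      · have e1 := stairPart_anti_left hc (p := p) (q := e - k') (p' - p) (by omega) (by omega)
        have e2 := stairPart_mono_right hc (p := p) (q := e - k') (by omega) (k' - k) (by omega)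
        rw [show p + (p' - p) = p' by omega] at e1
        rw [show e - k' + (k' - k) = e - k by omega] at e2
        omega
      all_goals omega
    · dsimp only
      rw [if_neg (by omega)]⟩
  left_inv g := by
    obtain ⟨g, h1, h2, h3⟩ := g
    apply Subtype.ext
    ext p k
    dsimp only
    split_ifs with h4
    · rw [stairPart]
      rw [if_pos (by omega), if_neg (by omega),
        show (p + (e - k)) / 2 - ((p + (e - k)) / 2 - p) = p by omega,
        show e - ((p + (e - k) + 1) / 2 + ((p + (e - k)) / 2 - p)) = k by omega]
      omega
    · exact (h3 p k (by omega)).symm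
  right_inv c := by
    obtain ⟨c, hc⟩ := c
    apply Subtype.ext
    ext x i
    dsimp only
    by_cases h1 : x ≤ 2 * e + 1 ∧ i ≤ x / 2
    · rw [if_pos h1]
      have h3 := cast_stair_eq (c := c) h1.2
      split_ifs with h2 h4
      · rw [stairPart_of_lt hc h2 (by omega)] at h3
        omega
      · rw [show e - (e - ((x + 1) / 2 + i)) = (x + 1) / 2 + i by omega]
        have := stairPart_nonneg hc (p := x / 2 - i) (q := (x + 1) / 2 + i) (by omega) (by omega)
        omega
      · omega
    · rw [if_neg h1]
      by_cases h2 : x ≤ 2 * e + 1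
      · rcases Nat.lt_or_ge x (2 * e + 1) with h3 | h3
        · exact (stair_zero hc h3 (by omega)).symm
        · rw [show x = 2 * e + 1 by omega, (mem_chains.1 hc).1, shiftRow, if_neg (by omega)]
      · rw [(mem_chains.1 hc).2.2 x (by omega)]
        rfl

/-- The height functions of transpose-complement plane partitions, given by the parts above half
height. -/
def heightFnsEquivStairFns (a n : ℕ) :
    {h : heightFns (2 * a) (n + 1) //
      ∀ j k, j < n + 1 → k < n + 1 → h.1 j k + h.1 (n - k) (n - j) = 2 * a} ≃ stairFns a n where
  toFun h := ⟨fun j k => h.1.1 j k - a, by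
    obtain ⟨⟨h, h1, h2, h3⟩, h4⟩ := h
    refine ⟨fun j k => ?_, fun j k j' k' hj hk => ?_, fun j k hjk => ?_⟩
    · have := h1 j k
      dsimp only
      omega
    · have := h2 j k j' k' hj hk
      dsimp only
      omega
    · dsimp only at h4 ⊢
      by_cases hj : n + 1 ≤ j ∨ n + 1 ≤ k
      · rw [h3 j k hj]
        omega
      -- For `n ≤ j + k` the mirror cell is below `(j, k)` in both coordinates, so `h j k` is the
      -- smaller of two heights with sum `2 * a`.
      · have e1 := h4 j k (by omega) (by omega)
        have e2 := h2 (n - k) (n - j) j k (by omega) (by omega)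
        omega⟩
  -- Of a cell and its mirror image at least one is outside the staircase, so one of the two values
  -- of `g` vanishes; the subtraction never truncates since `g ≤ a`.
  invFun g := ⟨⟨fun j k => if j ≤ n ∧ k ≤ n then a + g.1 j k - g.1 (n - k) (n - j) else 0,
    by
      obtain ⟨g, h1, h2, h3⟩ := g
      refine ⟨fun j k => ?_, fun j k j' k' hj hk => ?_, fun j k hjk => ?_⟩
      · have := h1 j k
        dsimp only
        split_ifs <;> omega
      · have e1 := h2 j k j' k' hj hk
        have e2 := h2 (n - k') (n - j') (n - k) (n - j) (by omega) (by omega)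
        dsimp only
        split_ifs <;> omega
      · dsimp only
        rw [if_neg (by omega)]⟩, by
      obtain ⟨g, h1, h2, h3⟩ := g
      intro j k hj hk
      have e1 := h1 j k
      have e2 := h1 (n - k) (n - j)
      dsimp only
      rw [if_pos (by omega), if_pos (by omega), show n - (n - j) = j by omega,
        show n - (n - k) = k by omega]
      omega⟩
  left_inv := by
    rintro ⟨⟨h, h1, h2, h3⟩, h4⟩
    apply Subtype.ext
    apply Subtype.ext
    ext j k
    dsimp only at h4 ⊢
    split_ifs with hjk
    · have := h4 j k (by omega) (by omega)
      omega
    · exact (h3 j k (by omega)).symm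
  right_inv := by
    rintro ⟨g, h1, h2, h3⟩
    apply Subtype.ext
    ext j k
    dsimp only
    have e0 := h3 j k
    split_ifs with hjk
    · have e1 := h3 (n - k) (n - j)
      rcases Nat.lt_or_ge (j + k) n with h | h
      · rw [e1 (by omega)]
        omega
      · rw [e0 h]
        omega
    · rw [e0 (by omega)]
      omega

/-- A transpose-complement plane partition is given by the parts above half height. -/
noncomputable def tcppEquivStairFns (a n : ℕ) :
    {π : PlanePartition (2 * a) (n + 1) (n + 1) // π.IsTransposeComplement} ≃ stairFns a n :=
  (Equiv.subtypeEquiv (PlanePartition.equivHeightFns (2 * a) (n + 1))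
    fun π => π.isTransposeComplement_iff).trans (heightFnsEquivStairFns a n)

theorem numTCPP_eq (a n : ℕ) :
    (numTCPP (2 * a) (n + 1) : ℚ) =
      ∏ j ∈ range n, ∏ i ∈ range (j + 1), ((2 * a + 2 + i + j : ℚ) / (2 + i + j)) := by
  rw [numTCPP, Nat.card_congr (tcppEquivStairFns a n)]
  -- The model by chains covers staircases of size `e + 1`; the empty staircase is separate.
  rcases n with _ | n
  · have : stairFns a 0 = {fun _ _ => 0} := by
      ext g
      constructor
      · rintro ⟨-, -, h⟩
        ext j k
        exact h j k (by omega)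
      · rintro rfl
        exact ⟨fun _ _ => Nat.zero_le _, fun _ _ _ _ _ _ => le_rfl, fun _ _ _ => rfl⟩
    rw [this]
    simp
  · rw [← card_chains_stairPre_shiftRow, Nat.card_congr (stairFnsEquivChains a n)]
    simp

theorem numTCPP_zero (m : ℕ) : numTCPP m 0 = 1 := by
  rw [numTCPP, Nat.card_eq_one_iff_unique]
  refine ⟨⟨fun π ρ => ?_⟩, ⟨⟨⊥, fun _ j => j.elim0⟩⟩⟩
  apply Subtype.ext
  ext ⟨_, j, _⟩
  exact j.elim0

/-! ### From half triangles to matchings of the quotient graph. -/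

section StairRows

variable {a e : ℕ} {c : ℕ → ℕ → ℕ}

theorem stair_le (hc : c ∈ chains stairPre (2 * e + 1) (shiftRow a (e + 1))) {x i : ℕ}
    (hx : x ≤ 2 * e + 1) (hi : i ≤ x / 2) : c x i ≤ a + i := by
  have h1 := cast_stair_eq (c := c) hi
  have h2 := stairPart_le hc (p := x / 2 - i) (q := (x + 1) / 2 + i) (by omega) (by omega)
  omega

theorem stair_frozen (hc : c ∈ chains stairPre (2 * e + 1) (shiftRow a (e + 1))) {x i : ℕ}
    (hx : x ≤ 2 * e + 1) (hi : i ≤ x / 2) (h : e < (x + 1) / 2 + i) : c x i = a + i := by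
  have h1 := cast_stair_eq (c := c) hi
  have h2 := stairPart_of_lt hc (p := x / 2 - i) (q := (x + 1) / 2 + i) h (by omega)
  omega

theorem stair_lt_succ (hc : c ∈ chains stairPre (2 * e + 1) (shiftRow a (e + 1))) {x i : ℕ}
    (hx : x ≤ 2 * e + 1) (hi : i + 1 ≤ x / 2) : c x i < c x (i + 1) := by
  rcases Nat.lt_or_ge x (2 * e + 1) with h | h
  · rcases Nat.mod_two_eq_zero_or_one x with h2 | h2
    · exact (stair_even hc h h2 (by omega)).trans_lt (stair_even_succ hc h h2 hi)
    · exact (stair_odd hc h h2 (by omega)).2.trans_le (stair_odd hc h h2 hi).1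
  · rw [show x = 2 * e + 1 by omega, (mem_chains.1 hc).1]
    exact shiftRow_lt (by omega)

theorem stair_lt (hc : c ∈ chains stairPre (2 * e + 1) (shiftRow a (e + 1))) {x i j : ℕ}
    (hx : x ≤ 2 * e + 1) (hij : i < j) (hj : j ≤ x / 2) : c x i < c x j := by
  obtain ⟨k, rfl⟩ := Nat.exists_eq_add_of_lt hij
  clear hij
  induction k with
  | zero => exact stair_lt_succ hc hx hj
  | succ k ih => exact (ih (by omega)).trans (stair_lt_succ hc hx (by omega))

theorem stair_mono (hc : c ∈ chains stairPre (2 * e + 1) (shiftRow a (e + 1))) {x i j : ℕ}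
    (hx : x ≤ 2 * e + 1) (hij : i ≤ j) (hj : j ≤ x / 2) : c x i ≤ c x j := by
  rcases hij.eq_or_lt with rfl | h
  · exact le_rfl
  · exact (stair_lt hc hx h hj).le

end StairRows

namespace Honeycomb

variable {a e : ℕ} {c : ℕ → ℕ → ℕ}

theorem mem_quotWhite {x y z : ℕ} : (x, y, z) ∈ quotWhite (2 * a) (e + 1) ↔
    x < 2 * e + 2 ∧ z < 2 * a + e + 1 ∧ x + y + z = 2 * (a + e) ∧ y ≤ z := by
  simp only [quotWhite, white, region, mem_filter, mem_product, mem_range]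
  omega

theorem mem_quotBlack {x y z : ℕ} : (x, y, z) ∈ quotBlack (2 * a) (e + 1) ↔
    x < 2 * e + 2 ∧ z < 2 * a + e + 1 ∧ x + y + z = 2 * (a + e) + 1 ∧ y ≤ z := by
  simp only [quotBlack, black, region, mem_filter, mem_product, mem_range]
  omega

/-- The central symmetry of the hexagon exchanges the colors; composed with the reflection it
preserves the closed half. -/
theorem card_quotWhite_eq (m b : ℕ) : (quotWhite m b).card = (quotBlack m b).card := by
  refine card_nbij' (fun v => (2 * b - 1 - v.1, m + b - 1 - v.2.2, m + b - 1 - v.2.1))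
    (fun v => (2 * b - 1 - v.1, m + b - 1 - v.2.2, m + b - 1 - v.2.1)) ?_ ?_ ?_ ?_
  all_goals
    rintro ⟨x, y, z⟩ h
    simp only [quotWhite, white, quotBlack, black, region, coe_filter, mem_filter, mem_product,
      mem_range, Set.mem_ofPred_eq, Prod.mk.injEq] at h ⊢
    omega

/-- The vertical edge at a white vertex is present when the row of the chain has an entry there. -/
def IsEntry (a e : ℕ) (c : ℕ → ℕ → ℕ) (w : Vertex) : Prop :=
  ∃ i ≤ w.1 / 2, c w.1 i + (a + e) = w.2.2 + w.1 / 2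

/-- A white vertex without vertical edge is matched away from the axis. -/
def IsOutward (a e : ℕ) (c : ℕ → ℕ → ℕ) (w : Vertex) : Prop :=
  if w.1 % 2 = 0 then
    ∃ j ≤ w.1 / 2, (∀ l < j, c (w.1 - 1) l + (a + e) < w.2.2 + w.1 / 2) ∧
      w.2.2 + w.1 / 2 < c w.1 j + (a + e)
  else
    ∃ j ≤ w.1 / 2, c (w.1 - 1) j + (a + e) ≤ w.2.2 + w.1 / 2 ∧
      w.2.2 + w.1 / 2 < c w.1 j + (a + e)

open Classical in
/-- The partner of a white vertex in the matching that belongs to a chain. -/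
noncomputable def partner (a e : ℕ) (c : ℕ → ℕ → ℕ) (w : Vertex) : Vertex :=
  if IsEntry a e c w then w + e₁ else if IsOutward a e c w then w + e₃ else w + e₂

theorem adj_partner (w : Vertex) : Adj w (partner a e c w) := by
  rw [partner, Adj]
  split_ifs <;> simp

theorem partner_mem (hc : c ∈ chains stairPre (2 * e + 1) (shiftRow a (e + 1))) {w : Vertex}
    (hw : w ∈ quotWhite (2 * a) (e + 1)) : partner a e c w ∈ quotBlack (2 * a) (e + 1) := by
  obtain ⟨x, y, z⟩ := w
  rw [mem_quotWhite] at hw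
  rw [partner]
  split_ifs with h1 h2
  · obtain ⟨i, hi, h1⟩ := h1
    simp only at hi h1
    simp only [e₁, Prod.mk_add_mk, mem_quotBlack]
    -- The entries of the last row are `a, …, a + e`, all beyond the graph, so no vertical edge
    -- leaves that row.
    rcases eq_or_ne x (2 * e + 1) with rfl | hx
    · have := stair_frozen hc le_rfl hi (by omega)
      omega
    · omega
  · have h3 : ∃ j ≤ x / 2, z + x / 2 < c x j + (a + e) := by
      rw [IsOutward] at h2
      split_ifs at h2 with h
      · obtain ⟨j, hj, -, h2⟩ := h2
        exact ⟨j, hj, h2⟩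
      · obtain ⟨j, hj, -, h2⟩ := h2
        exact ⟨j, hj, h2⟩
    obtain ⟨j, hj, h3⟩ := h3
    have := stair_le hc (x := x) (by omega) hj
    simp only [e₃, Prod.mk_add_mk, mem_quotBlack]
    omega
  · simp only [e₂, Prod.mk_add_mk, mem_quotBlack]
    have h4 : y ≠ z := by
      rintro rfl
      apply h2
      rw [IsOutward, if_pos (by dsimp only; omega)]
      refine ⟨0, Nat.zero_le _, by simp, ?_⟩
      by_contra h
      apply h1
      refine ⟨0, Nat.zero_le _, ?_⟩
      dsimp only at h ⊢
      omega
    omega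

/-- A black vertex could be chosen by two of its three white neighbours in three ways; this lemma
and the next two exclude one each, which makes `partner` injective. -/
theorem not_isEntry_of_isOutward_pred (hc : c ∈ chains stairPre (2 * e + 1) (shiftRow a (e + 1)))
    {x y y' z : ℕ} (hx : x + 1 ≤ 2 * e + 1) (h : IsOutward a e c (x + 1, y, z)) :
    ¬ IsEntry a e c (x, y', z + 1) := by
  rintro ⟨i, hi, h1⟩
  simp only [IsOutward, Nat.add_sub_cancel] at hi h1 h
  split_ifs at h with h2
  · obtain ⟨j, hj, h3, h4⟩ := h
    have hji : j ≤ i := by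
      by_contra! hlt
      have := h3 i hlt
      omega
    have e1 := stair_mono hc hx hji (by omega)
    have e2 := stair_odd hc (x := x) (by omega) (by omega) hi
    omega
  · obtain ⟨j, hj, h3, h4⟩ := h
    have hji : j < i := by
      by_contra! hlt
      have := stair_mono hc (x := x) (by omega) hlt (by omega)
      omega
    have e1 := stair_even_succ hc (x := x) (i := j) (by omega) (by omega) (by omega)
    have e2 := stair_mono hc (x := x) (by omega) (show j + 1 ≤ i by omega) (by omega)
    omega

theorem isOutward_of_isEntry_pred (hc : c ∈ chains stairPre (2 * e + 1) (shiftRow a (e + 1)))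
    {x y y' z : ℕ} (hx : x + 1 ≤ 2 * e + 1) (h : IsEntry a e c (x, y', z))
    (h' : ¬ IsEntry a e c (x + 1, y, z)) : IsOutward a e c (x + 1, y, z) := by
  obtain ⟨i, hi, h1⟩ := h
  have h'' : ∀ j ≤ (x + 1) / 2, c (x + 1) j + (a + e) ≠ z + (x + 1) / 2 :=
    fun j hj hne => h' ⟨j, hj, hne⟩
  simp only [IsOutward, Nat.add_sub_cancel] at hi h1 ⊢
  split_ifs with h2
  · have e1 := stair_odd hc (x := x) (by omega) (by omega) hi
    have e2 := h'' (i + 1) (by omega)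
    refine ⟨i + 1, by omega, fun l hl => ?_, by omega⟩
    have := stair_mono hc (x := x) (by omega) (show l ≤ i by omega) (by omega)
    omega
  · have e1 := stair_even hc (x := x) (by omega) (by omega) hi
    have e2 := h'' i (by omega)
    exact ⟨i, by omega, by omega, by omega⟩

theorem isOutward_of_isOutward_pred {x y y' z : ℕ} (h : IsOutward a e c (x, y, z))
    (h' : ¬ IsEntry a e c (x, y', z + 1)) : IsOutward a e c (x, y', z + 1) := by
  have h'' : ∀ j ≤ x / 2, c x j + (a + e) ≠ z + 1 + x / 2 :=
    fun j hj hne => h' ⟨j, hj, hne⟩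
  simp only [IsOutward] at h ⊢
  split_ifs at h ⊢ with h2
  · obtain ⟨j, hj, h3, h4⟩ := h
    have := h'' j hj
    refine ⟨j, hj, fun l hl => ?_, by omega⟩
    have := h3 l hl
    omega
  · obtain ⟨j, hj, h3, h4⟩ := h
    have := h'' j hj
    exact ⟨j, hj, by omega, by omega⟩

theorem partner_injOn (hc : c ∈ chains stairPre (2 * e + 1) (shiftRow a (e + 1))) :
    Set.InjOn (partner a e c) (quotWhite (2 * a) (e + 1)) := by
  rintro ⟨x, y, z⟩ hw ⟨x', y', z'⟩ hw' h
  rw [mem_coe, mem_quotWhite] at hw hw'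
  simp only [partner] at h
  split_ifs at h with h1 h2 h3 h4 h5 h6 h7 <;>
    simp only [e₁, e₂, e₃, Prod.mk_add_mk, Prod.mk.injEq, add_zero] at h
  · simp only [Prod.mk.injEq]; omega
  · obtain ⟨rfl, rfl, rfl⟩ := h
    exact absurd h1 (not_isEntry_of_isOutward_pred hc (by omega) h3)
  · obtain ⟨rfl, rfl, rfl⟩ := h
    exact absurd (isOutward_of_isEntry_pred hc (by omega) h1 h2) h3
  · obtain ⟨rfl, rfl, rfl⟩ := h
    exact absurd h5 (not_isEntry_of_isOutward_pred hc (by omega) h4)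
  · simp only [Prod.mk.injEq]; omega
  · obtain ⟨rfl, rfl, rfl⟩ := h
    exact absurd (isOutward_of_isOutward_pred h4 h5) h6
  · obtain ⟨rfl, rfl, rfl⟩ := h
    exact absurd (isOutward_of_isEntry_pred hc (by omega) h7 h1) h4
  · obtain ⟨rfl, rfl, rfl⟩ := h
    rename_i h8
    exact absurd (isOutward_of_isOutward_pred h8 h1) h4
  · simp only [Prod.mk.injEq]; omega

/-- The matching that belongs to a chain. -/
noncomputable def chainMatching (hc : c ∈ chains stairPre (2 * e + 1) (shiftRow a (e + 1))) :
    quotWhite (2 * a) (e + 1) ≃ quotBlack (2 * a) (e + 1) :=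
  Equiv.ofBijective (fun w => ⟨partner a e c w, partner_mem hc w.2⟩)
    ((Fintype.bijective_iff_injective_and_card _).2
      ⟨fun v w h => Subtype.ext (partner_injOn hc v.2 w.2 (congrArg Subtype.val h)),
        by simpa using card_quotWhite_eq (2 * a) (e + 1)⟩)

theorem chainMatching_apply (hc : c ∈ chains stairPre (2 * e + 1) (shiftRow a (e + 1)))
    (w : quotWhite (2 * a) (e + 1)) : (chainMatching hc w : Vertex) = partner a e c w := rfl

theorem chainMatching_mem (hc : c ∈ chains stairPre (2 * e + 1) (shiftRow a (e + 1))) :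
    chainMatching hc ∈ perfectMatchings (quotWhite (2 * a) (e + 1)) (quotBlack (2 * a) (e + 1)) :=
  mem_filter.2 ⟨mem_univ _, fun w => adj_partner w.1⟩

theorem isEntry_iff_partner_eq {w : Vertex} : IsEntry a e c w ↔ partner a e c w = w + e₁ := by
  obtain ⟨x, y, z⟩ := w
  rw [partner]
  split_ifs with h1 h2 <;> simp [h1, e₁, e₂, e₃]

/-- The vertical edges show the set of entries of each row, apart from the frozen ones, and a
strictly increasing row is determined by its set of entries. -/
theorem chainMatching_injective {d : ℕ → ℕ → ℕ}
    (hc : c ∈ chains stairPre (2 * e + 1) (shiftRow a (e + 1)))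
    (hd : d ∈ chains stairPre (2 * e + 1) (shiftRow a (e + 1)))
    (h : chainMatching hc = chainMatching hd) : c = d := by
  have key : ∀ {c d : ℕ → ℕ → ℕ} (hc : c ∈ chains stairPre (2 * e + 1) (shiftRow a (e + 1)))
      (hd : d ∈ chains stairPre (2 * e + 1) (shiftRow a (e + 1))),
      chainMatching hc = chainMatching hd → ∀ x i, x < 2 * e + 1 → i ≤ x / 2 →
        ∃ j ≤ x / 2, d x j = c x i := by
    intro c d hc hd h x i hx hi
    rcases Nat.lt_or_ge e ((x + 1) / 2 + i) with h1 | h1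
    · exact ⟨i, hi, by rw [stair_frozen hc hx.le hi h1, stair_frozen hd hx.le hi h1]⟩
    · have h2 := stair_le hc hx.le hi
      have hw : (x, a + e - (x + 1) / 2 - c x i, a + e - x / 2 + c x i) ∈
          quotWhite (2 * a) (e + 1) := by
        rw [mem_quotWhite]
        omega
      have h3 := congrArg Subtype.val (DFunLike.congr_fun h ⟨_, hw⟩)
      rw [chainMatching_apply, chainMatching_apply] at h3
      have h4 : IsEntry a e c (x, a + e - (x + 1) / 2 - c x i, a + e - x / 2 + c x i) :=
        ⟨i, hi, by dsimp only; omega⟩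
      rw [isEntry_iff_partner_eq] at h4
      rw [h4, eq_comm, ← isEntry_iff_partner_eq] at h3
      obtain ⟨j, hj, h5⟩ := h3
      exact ⟨j, hj, by dsimp only at h5; omega⟩
  ext x i
  rcases lt_trichotomy x (2 * e + 1) with hx | rfl | hx
  · rcases Nat.lt_or_ge (x / 2) i with hi | hi
    · rw [stair_zero hc hx hi, stair_zero hd hx hi]
    · have := (StrictMono.range_inj (f := fun i : Fin (x / 2 + 1) => c x i)
        (g := fun i : Fin (x / 2 + 1) => d x i)
        (fun i j hij => stair_lt hc hx.le hij (by omega))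
        (fun i j hij => stair_lt hd hx.le hij (by omega))).1 (by
          apply Set.Subset.antisymm
          · rintro _ ⟨i, rfl⟩
            obtain ⟨j, hj, h1⟩ := key hc hd h x i hx (by omega)
            exact ⟨⟨j, by omega⟩, h1⟩
          · rintro _ ⟨i, rfl⟩
            obtain ⟨j, hj, h1⟩ := key hd hc h.symm x i hx (by omega)
            exact ⟨⟨j, by omega⟩, h1⟩)
      exact congrFun this ⟨i, by omega⟩
  · rw [(mem_chains.1 hc).1, (mem_chains.1 hd).1]
  · rw [(mem_chains.1 hc).2.2 x hx, (mem_chains.1 hd).2.2 x hx]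

/-- A vertical edge from an axis vertex stays on the axis, every other edge leaves it. The axis
vertex has index 0, so its edge is vertical exactly when the first entry of the row is 0. -/
theorem edgeWeight_partner (hc : c ∈ chains stairPre (2 * e + 1) (shiftRow a (e + 1))) {w : Vertex}
    (hw : w ∈ quotWhite (2 * a) (e + 1)) :
    edgeWeight w (partner a e c w) = if OnAxis w ∧ c w.1 0 ≠ 0 then 2 else 1 := by
  obtain ⟨x, y, z⟩ := w
  rw [mem_quotWhite] at hw
  rw [edgeWeight]
  refine if_congr (and_congr_right fun h => ?_) rfl rfl
  obtain rfl : z = y := congrArg (fun v : Vertex => v.2.1) h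
  have hE : IsEntry a e c (x, z, z) ↔ c x 0 = 0 := by
    constructor
    · rintro ⟨i, hi, h1⟩
      have := stair_mono hc (x := x) (by omega) (Nat.zero_le i) hi
      dsimp only at h1
      omega
    · intro h0
      exact ⟨0, Nat.zero_le _, by dsimp only; omega⟩
  rw [partner]
  split_ifs with h1 h2
  · simp [OnAxis, reflect, e₁, hE.1 h1]
  · simp [OnAxis, reflect, e₃, mt hE.2 h1]
  · simp [OnAxis, reflect, e₂, mt hE.2 h1]

theorem prod_edgeWeight_chainMatching
    (hc : c ∈ chains stairPre (2 * e + 1) (shiftRow a (e + 1))) :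
    ((∏ w : quotWhite (2 * a) (e + 1), edgeWeight w (chainMatching hc w) : ℕ) : ℚ) =
      ∏ r ∈ range (2 * e + 1), (if r % 2 = 0 then twoWeight (c r 0) else 1) := by
  have h1 : ∏ w : quotWhite (2 * a) (e + 1), edgeWeight w (chainMatching hc w) =
      ∏ w ∈ quotWhite (2 * a) (e + 1), if OnAxis w ∧ c w.1 0 ≠ 0 then 2 else 1 := by
    rw [← prod_coe_sort (quotWhite (2 * a) (e + 1))]
    exact prod_congr rfl fun w _ => edgeWeight_partner hc w.2
  have h2 : ∀ w ∈ quotWhite (2 * a) (e + 1), w.1 ∈ range (2 * e + 2) := by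
    rintro ⟨x, y, z⟩ h
    exact mem_range.2 (mem_quotWhite.1 h).1
  rw [h1, ← prod_fiberwise_of_maps_to h2, Nat.cast_prod, prod_range_succ _ (2 * e + 1)]
  -- An even row contains exactly one white axis vertex, an odd row none. The last row is odd and
  -- contributes nothing.
  have h3 : ∀ x ∈ range (2 * e + 2), ∏ w ∈ quotWhite (2 * a) (e + 1) with w.1 = x,
      (if OnAxis w ∧ c w.1 0 ≠ 0 then 2 else 1) =
      if x % 2 = 0 ∧ c x 0 ≠ 0 then 2 else 1 := by
    intro x hx
    rw [mem_range] at hx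
    rcases Nat.mod_two_eq_zero_or_one x with hm | hm
    · rw [prod_eq_single (x, a + e - x / 2, a + e - x / 2)]
      · simp [OnAxis, reflect, hm]
      · rintro ⟨x', y, z⟩ h hne
        rw [mem_filter, mem_quotWhite] at h
        obtain ⟨h, rfl⟩ := h
        rw [if_neg]
        rintro ⟨h4, -⟩
        obtain rfl : z = y := congrArg (fun v : Vertex => v.2.1) h4
        apply hne
        dsimp only at hm ⊢
        simp only [Prod.mk.injEq]
        exact ⟨trivial, by omega, by omega⟩
      · intro h
        exfalso
        apply h
        rw [mem_filter, mem_quotWhite]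
        omega
    · rw [if_neg (by omega)]
      refine prod_eq_one ?_
      rintro ⟨x', y, z⟩ h
      rw [mem_filter, mem_quotWhite] at h
      obtain ⟨h, rfl⟩ := h
      rw [if_neg]
      rintro ⟨h4, -⟩
      obtain rfl : z = y := congrArg (fun v : Vertex => v.2.1) h4
      dsimp only at hm
      omega
  rw [h3 _ (by simp), if_neg (by omega), Nat.cast_one, mul_one]
  refine prod_congr rfl fun x hx => ?_
  rw [h3 x (by rw [mem_range] at hx ⊢; omega), twoWeight]
  split_ifs <;> first | rfl | omega

end Honeycomb

/-! ### From matchings back to half triangles, by counting vertical edges. -/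

namespace Honeycomb

variable {a e : ℕ}

/-- The white vertex of row `x` at index `D`, counted from the axis. -/
def rowWhite (a e x D : ℕ) : Vertex := (x, a + e - (x + 1) / 2 - D, a + e - x / 2 + D)

theorem rowWhite_mem {x D : ℕ} (hx : x ≤ 2 * e + 1) (h1 : D + (x + 1) / 2 ≤ a + e)
    (h2 : D ≤ a + x / 2) : rowWhite a e x D ∈ quotWhite (2 * a) (e + 1) := by
  rw [rowWhite, mem_quotWhite]
  omega

section Matching

variable (f : quotWhite (2 * a) (e + 1) ≃ quotBlack (2 * a) (e + 1))

/-- A white vertex of the graph at index `D` of row `x` whose matching edge has direction `d`. -/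
def HasEdge (d : Vertex) (x D : ℕ) : Prop :=
  ∃ h : rowWhite a e x D ∈ quotWhite (2 * a) (e + 1),
    D + (x + 1) / 2 ≤ a + e ∧ (f ⟨_, h⟩ : Vertex) = rowWhite a e x D + d

/-- The index `D` of row `x` carries a vertical edge, in the graph or in its extension. -/
def IsVert (x D : ℕ) : Prop :=
  D ≤ a + x / 2 ∧ (a + e < D + (x + 1) / 2 ∨ HasEdge f e₁ x D)

/-- The black vertex of row `x` at the end of the vertical edge with index `D` is matched by it. -/
def IsVertPred (x D : ℕ) : Prop := 0 < x ∧ IsVert f (x - 1) D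

variable {f}

theorem HasEdge.le {d : Vertex} {x D : ℕ} (h : HasEdge f d x D) :
    D + (x + 1) / 2 ≤ a + e ∧ D ≤ a + x / 2 ∧ x ≤ 2 * e + 1 := by
  obtain ⟨h, h1, -⟩ := h
  rw [rowWhite, mem_quotWhite] at h
  omega

theorem HasEdge.dir_eq {d d' : Vertex} {x D : ℕ} (h : HasEdge f d x D) (h' : HasEdge f d' x D) :
    d = d' := by
  obtain ⟨h, -, h1⟩ := h
  obtain ⟨h', -, h2⟩ := h'
  exact add_left_cancel (h1.symm.trans h2)

theorem HasEdge.eq {d d' : Vertex} {x D x' D' : ℕ} (h : HasEdge f d x D) (h' : HasEdge f d' x' D')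
    (hv : rowWhite a e x D + d = rowWhite a e x' D' + d') : rowWhite a e x D = rowWhite a e x' D' := by
  obtain ⟨h, -, h1⟩ := h
  obtain ⟨h', -, h2⟩ := h'
  have : f ⟨_, h⟩ = f ⟨_, h'⟩ := Subtype.ext (by rw [h1, h2, hv])
  exact congrArg Subtype.val (f.injective this)

theorem not_isVert_of_hasEdge {d : Vertex} {x D : ℕ} (h : HasEdge f d x D) (hd : d ≠ e₁) :
    ¬ IsVert f x D := by
  rintro ⟨-, h1 | h1⟩
  · have := h.le
    omega
  · exact hd (h.dir_eq h1)

theorem exists_hasEdge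
    (hf : f ∈ perfectMatchings (quotWhite (2 * a) (e + 1)) (quotBlack (2 * a) (e + 1)))
    {x D : ℕ} (hx : x ≤ 2 * e + 1) (h1 : D + (x + 1) / 2 ≤ a + e) (h2 : D ≤ a + x / 2) :
    HasEdge f e₁ x D ∨ HasEdge f e₂ x D ∨ HasEdge f e₃ x D := by
  have hw := rowWhite_mem hx h1 h2
  rcases (mem_filter.1 hf).2 ⟨_, hw⟩ with h | h | h
  · exact Or.inl ⟨hw, h1, h⟩
  · exact Or.inr (Or.inl ⟨hw, h1, h⟩)
  · exact Or.inr (Or.inr ⟨hw, h1, h⟩)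

theorem white_cases
    (hf : f ∈ perfectMatchings (quotWhite (2 * a) (e + 1)) (quotBlack (2 * a) (e + 1)))
    {x D : ℕ} (hx : x ≤ 2 * e + 1) (h2 : D ≤ a + x / 2) :
    IsVert f x D ∨ HasEdge f e₂ x D ∨ HasEdge f e₃ x D := by
  rcases Nat.lt_or_ge (a + e) (D + (x + 1) / 2) with h1 | h1
  · exact Or.inl ⟨h2, Or.inl h1⟩
  · rcases exists_hasEdge hf hx h1 h2 with h | h
    · exact Or.inl ⟨h2, Or.inr h⟩
    · exact Or.inr h

theorem black_cases
    (hf : f ∈ perfectMatchings (quotWhite (2 * a) (e + 1)) (quotBlack (2 * a) (e + 1)))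
    {x y z : ℕ} (hv : (x, y, z) ∈ quotBlack (2 * a) (e + 1)) :
    (∃ D, HasEdge f e₁ (x - 1) D ∧ 0 < x ∧ z = a + e - (x - 1) / 2 + D) ∨
      (∃ D, HasEdge f e₂ x D ∧ z = a + e - x / 2 + D) ∨
      ∃ D, HasEdge f e₃ x D ∧ z = a + e - x / 2 + D + 1 := by
  obtain ⟨⟨⟨x', y', z'⟩, hw⟩, h⟩ := f.surjective ⟨_, hv⟩
  have hadj := (mem_filter.1 hf).2 ⟨_, hw⟩
  rw [h] at hadj
  have hw' := mem_quotWhite.1 hw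
  have hrow : (x', y', z') = rowWhite a e x' (z' + x' / 2 - (a + e)) := by
    simp only [rowWhite, Prod.mk.injEq]
    exact ⟨trivial, by omega, by omega⟩
  have hedge : ∀ d, (x, y, z) = (x', y', z') + d → HasEdge f d x' (z' + x' / 2 - (a + e)) := by
    intro d hd
    refine ⟨hrow ▸ hw, by omega, ?_⟩
    have : f ⟨rowWhite a e x' (z' + x' / 2 - (a + e)), hrow ▸ hw⟩ = f ⟨_, hw⟩ := by
      congr 2
      exact hrow.symm
    rw [this, h, ← hrow, ← hd]
  rcases hadj with h1 | h1 | h1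
  · refine Or.inl ⟨z' + x' / 2 - (a + e), ?_, ?_⟩
    · simp only [e₁, Prod.mk_add_mk, Prod.mk.injEq] at h1
      rw [show x - 1 = x' by omega]
      exact hedge _ (by simp [e₁, h1])
    · simp only [e₁, Prod.mk_add_mk, Prod.mk.injEq] at h1
      rw [show x - 1 = x' by omega]
      omega
  · refine Or.inr (Or.inl ⟨z' + x' / 2 - (a + e), ?_, ?_⟩)
    · simp only [e₂, Prod.mk_add_mk, Prod.mk.injEq] at h1
      rw [show x = x' by omega]
      exact hedge _ (by simp [e₂, h1])
    · simp only [e₂, Prod.mk_add_mk, Prod.mk.injEq] at h1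
      rw [show x = x' by omega]
      omega
  · refine Or.inr (Or.inr ⟨z' + x' / 2 - (a + e), ?_, ?_⟩)
    · simp only [e₃, Prod.mk_add_mk, Prod.mk.injEq] at h1
      rw [show x = x' by omega]
      exact hedge _ (by simp [e₃, h1])
    · simp only [e₃, Prod.mk_add_mk, Prod.mk.injEq] at h1
      rw [show x = x' by omega]
      omega

theorem black_odd_cases
    (hf : f ∈ perfectMatchings (quotWhite (2 * a) (e + 1)) (quotBlack (2 * a) (e + 1)))
    {x D : ℕ} (hx : x ≤ 2 * e + 1) (hm : x % 2 = 1) (h2 : D ≤ a + x / 2) :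
    IsVertPred f x D ∨ (∃ D', D = D' + 1 ∧ HasEdge f e₃ x D') ∨ HasEdge f e₂ x D := by
  rcases Nat.lt_or_ge (a + e) (D + x / 2) with h1 | h1
  · exact Or.inl ⟨by omega, by omega, Or.inl (by omega)⟩
  · have hv : (x, a + e - x / 2 - D, a + e - x / 2 + D) ∈ quotBlack (2 * a) (e + 1) := by
      rw [mem_quotBlack]
      omega
    rcases black_cases hf hv with ⟨D', h, -, h3⟩ | ⟨D', h, h3⟩ | ⟨D', h, h3⟩
    · obtain rfl : D' = D := by omega
      exact Or.inl ⟨by omega, h.le.2.1, Or.inr h⟩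
    · obtain rfl : D' = D := by omega
      exact Or.inr (Or.inr h)
    · exact Or.inr (Or.inl ⟨D', by omega, h⟩)

theorem black_even_cases
    (hf : f ∈ perfectMatchings (quotWhite (2 * a) (e + 1)) (quotBlack (2 * a) (e + 1)))
    {x D : ℕ} (hx : x ≤ 2 * e + 1) (hm : x % 2 = 0) (h2 : D + 1 ≤ a + x / 2) :
    IsVertPred f x D ∨ HasEdge f e₃ x D ∨ HasEdge f e₂ x (D + 1) := by
  rcases Nat.lt_or_ge (a + e) (D + x / 2) with h1 | h1
  · exact Or.inl ⟨by omega, by omega, Or.inl (by omega)⟩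
  · have hv : (x, a + e - x / 2 - D, a + e - x / 2 + 1 + D) ∈ quotBlack (2 * a) (e + 1) := by
      rw [mem_quotBlack]
      omega
    rcases black_cases hf hv with ⟨D', h, h4, h3⟩ | ⟨D', h, h3⟩ | ⟨D', h, h3⟩
    · obtain rfl : D' = D := by omega
      exact Or.inl ⟨h4, h.le.2.1, Or.inr h⟩
    · obtain rfl : D' = D + 1 := by omega
      exact Or.inr (Or.inr h)
    · obtain rfl : D' = D := by omega
      exact Or.inr (Or.inl h)

theorem not_isVertPred_of_hasEdge {d : Vertex} {x D D' : ℕ} (h : HasEdge f d x D')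
    (h1 : D + x / 2 ≤ a + e) (hv : 0 < x → rowWhite a e (x - 1) D + e₁ = rowWhite a e x D' + d) :
    ¬ IsVertPred f x D := by
  rintro ⟨h0, -, h2 | h2⟩
  · omega
  · have := congrArg Prod.fst (h2.eq h (hv h0))
    simp only [rowWhite] at this
    omega

theorem not_isVertPred_odd_outward {x D : ℕ} (hm : x % 2 = 1) (h : HasEdge f e₃ x D) :
    ¬ IsVertPred f x (D + 1) := by
  have := h.le
  refine not_isVertPred_of_hasEdge h (by omega) fun _ => ?_
  simp only [rowWhite, e₁, e₃, Prod.mk_add_mk, Prod.mk.injEq]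
  omega

theorem not_isVertPred_odd_inward {x D : ℕ} (hm : x % 2 = 1) (h : HasEdge f e₂ x D) :
    ¬ IsVertPred f x D := by
  have := h.le
  refine not_isVertPred_of_hasEdge h (by omega) fun _ => ?_
  simp only [rowWhite, e₁, e₂, Prod.mk_add_mk, Prod.mk.injEq]
  omega

theorem not_isVertPred_even_outward {x D : ℕ} (hm : x % 2 = 0) (h : HasEdge f e₃ x D) :
    ¬ IsVertPred f x D := by
  have := h.le
  refine not_isVertPred_of_hasEdge h (by omega) fun _ => ?_
  simp only [rowWhite, e₁, e₃, Prod.mk_add_mk, Prod.mk.injEq]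
  omega

theorem not_isVertPred_even_inward {x D : ℕ} (hm : x % 2 = 0) (h : HasEdge f e₂ x (D + 1)) :
    ¬ IsVertPred f x D := by
  have := h.le
  refine not_isVertPred_of_hasEdge h (by omega) fun _ => ?_
  simp only [rowWhite, e₁, e₂, Prod.mk_add_mk, Prod.mk.injEq]
  omega

theorem not_inward_of_outward {x D : ℕ} (h : HasEdge f e₃ x D) : ¬ HasEdge f e₂ x (D + 1) := by
  intro h'
  have h1 := h.le
  have h2 := h'.le
  have := h.eq h' (by
    simp only [rowWhite, e₂, e₃, Prod.mk_add_mk, Prod.mk.injEq, true_and]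
    omega)
  simp only [rowWhite, Prod.mk.injEq] at this
  omega

theorem not_outward_last {x : ℕ} : ¬ HasEdge f e₃ x (a + x / 2) := by
  intro h
  have h1 := h.le
  obtain ⟨h, -, h3⟩ := h
  have h4 := (f ⟨_, h⟩).2
  rw [h3] at h4
  simp only [rowWhite, e₃, Prod.mk_add_mk, mem_quotBlack] at h4
  omega

theorem not_inward_zero {x : ℕ} (hm : x % 2 = 0) : ¬ HasEdge f e₂ x 0 := by
  intro h
  have h1 := h.le
  obtain ⟨h, -, h3⟩ := h
  have h4 := (f ⟨_, h⟩).2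
  rw [h3] at h4
  simp only [rowWhite, e₂, Prod.mk_add_mk, mem_quotBlack] at h4
  omega

-- Along an odd row black and white vertices alternate, starting with black. Among the first `D + 1`
-- of each color, the matching edges inside the row pair up except for an outward edge that crosses
-- the cut, so incoming and outgoing vertical edges balance up to that edge.
open Classical in
theorem count_odd
    (hf : f ∈ perfectMatchings (quotWhite (2 * a) (e + 1)) (quotBlack (2 * a) (e + 1)))
    {x : ℕ} (hx : x ≤ 2 * e + 1) (hm : x % 2 = 1) (D : ℕ) (h2 : D ≤ a + x / 2) :
    Nat.count (IsVertPred f x) (D + 1) =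
      Nat.count (IsVert f x) (D + 1) + if HasEdge f e₃ x D then 1 else 0 := by
  have step : ∀ D ≤ a + x / 2, Nat.count (IsVertPred f x) D = Nat.count (IsVert f x) D +
      (if ∃ D', D = D' + 1 ∧ HasEdge f e₃ x D' then 1 else 0) →
      Nat.count (IsVertPred f x) (D + 1) =
      Nat.count (IsVert f x) (D + 1) + if HasEdge f e₃ x D then 1 else 0 := by
    intro D hD ih
    rw [Nat.count_succ, Nat.count_succ, ih]
    by_cases h1 : ∃ D', D = D' + 1 ∧ HasEdge f e₃ x D'
    · have n1 : ¬ IsVertPred f x D := by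
        obtain ⟨D', rfl, h1⟩ := h1
        exact not_isVertPred_odd_outward hm h1
      have n2 : ¬ HasEdge f e₂ x D := by
        obtain ⟨D', rfl, h1⟩ := h1
        exact not_inward_of_outward h1
      rw [if_pos h1, if_neg n1]
      rcases white_cases hf hx hD with h3 | h3 | h3
      · rw [if_pos h3, if_neg fun h => not_isVert_of_hasEdge h (by decide) h3]
      · exact absurd h3 n2
      · rw [if_pos h3, if_neg (not_isVert_of_hasEdge h3 (by decide))]
    · rw [if_neg h1]
      by_cases h3 : HasEdge f e₂ x D
      · rw [if_neg (not_isVertPred_odd_inward hm h3), if_neg (not_isVert_of_hasEdge h3 (by decide)),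
          if_neg fun h => absurd (h.dir_eq h3) (by decide)]
      · have p1 : IsVertPred f x D := by
          rcases black_odd_cases hf hx hm hD with h | h | h
          · exact h
          · exact absurd h h1
          · exact absurd h h3
        rw [if_pos p1]
        rcases white_cases hf hx hD with h4 | h4 | h4
        · rw [if_pos h4, if_neg fun h => not_isVert_of_hasEdge h (by decide) h4]
        · exact absurd h4 h3
        · rw [if_pos h4, if_neg (not_isVert_of_hasEdge h4 (by decide))]
  induction D with
  | zero => exact step 0 h2 (by simp)
  | succ D ih =>
    refine step _ h2 ?_
    rw [ih (by omega)]
    simp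

-- The same balance along an even row, which starts with a white vertex on the axis; now the edge
-- across the cut is the inward one at `D`.
open Classical in
theorem count_even
    (hf : f ∈ perfectMatchings (quotWhite (2 * a) (e + 1)) (quotBlack (2 * a) (e + 1)))
    {x : ℕ} (hx : x ≤ 2 * e + 1) (hm : x % 2 = 0) (D : ℕ) (h2 : D ≤ a + x / 2) :
    Nat.count (IsVert f x) D =
      Nat.count (IsVertPred f x) D + if HasEdge f e₂ x D then 1 else 0 := by
  induction D with
  | zero => simp [not_inward_zero hm]
  | succ D ih =>
    rw [Nat.count_succ, Nat.count_succ, ih (by omega)]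
    by_cases h1 : HasEdge f e₂ x D
    · rw [if_pos h1, if_neg (not_isVert_of_hasEdge h1 (by decide))]
      rcases black_even_cases hf hx hm h2 with h3 | h3 | h3
      · rw [if_pos h3, if_neg fun h => not_isVertPred_even_inward hm h h3]
      · exact absurd (h1.dir_eq h3) (by decide)
      · rw [if_pos h3, if_neg (not_isVertPred_even_inward hm h3)]
    · rw [if_neg h1]
      by_cases h3 : HasEdge f e₃ x D
      · rw [if_neg (not_isVert_of_hasEdge h3 (by decide)),
          if_neg (not_isVertPred_even_outward hm h3), if_neg (not_inward_of_outward h3)]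
      · have p1 : IsVert f x D := by
          rcases white_cases hf hx (D := D) (by omega) with h | h | h
          · exact h
          · exact absurd h h1
          · exact absurd h h3
        rw [if_pos p1]
        rcases black_even_cases hf hx hm h2 with h4 | h4 | h4
        · rw [if_pos h4, if_neg fun h => not_isVertPred_even_inward hm h h4]
        · exact absurd h4 h3
        · rw [if_pos h4, if_neg (not_isVertPred_even_inward hm h4)]

open Classical in
theorem count_isVertPred {x : ℕ} (hx : 0 < x) (D : ℕ) :
    Nat.count (IsVertPred f x) D = Nat.count (IsVert f (x - 1)) D := by
  congr 1
  ext D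
  exact and_iff_right hx

-- No edge crosses the outer end of a row. An odd row therefore passes on as many vertical edges as
-- it receives, while an even row has one white vertex more than black ones and emits one more.
open Classical in
theorem count_total
    (hf : f ∈ perfectMatchings (quotWhite (2 * a) (e + 1)) (quotBlack (2 * a) (e + 1)))
    {x : ℕ} (hx : x ≤ 2 * e + 1) : Nat.count (IsVert f x) (a + x / 2 + 1) = x / 2 + 1 := by
  have even : ∀ x ≤ 2 * e + 1, x % 2 = 0 → Nat.count (IsVertPred f x) (a + x / 2) = x / 2 →
      Nat.count (IsVert f x) (a + x / 2 + 1) = x / 2 + 1 := by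
    intro x hx hm h
    rw [Nat.count_succ, count_even hf hx hm _ le_rfl, h]
    rcases white_cases hf hx (D := a + x / 2) le_rfl with h1 | h1 | h1
    · rw [if_pos h1, if_neg fun h => not_isVert_of_hasEdge h (by decide) h1]
    · rw [if_pos h1, if_neg (not_isVert_of_hasEdge h1 (by decide))]
    · exact absurd h1 not_outward_last
  induction x with
  | zero =>
    refine even 0 hx rfl ?_
    rw [Nat.count_iff_forall_not]
    rintro D - ⟨h, -⟩
    exact lt_irrefl _ h
  | succ x ih =>
    have h := ih (by omega)
    rcases Nat.mod_two_eq_zero_or_one (x + 1) with hm | hm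
    · refine even _ hx hm ?_
      rw [count_isVertPred (by omega), Nat.add_sub_cancel,
        show a + (x + 1) / 2 = a + x / 2 + 1 by omega, h]
      omega
    · have h1 := count_odd hf hx hm (a + (x + 1) / 2) le_rfl
      rw [if_neg not_outward_last, count_isVertPred (by omega), Nat.add_sub_cancel,
        show (x + 1) / 2 = x / 2 by omega, h] at h1
      rw [show (x + 1) / 2 = x / 2 by omega]
      exact h1.symm

end Matching

end Honeycomb

open Classical in
theorem Nat.nth_spec_of_lt_count {p : ℕ → Prop} {M i : ℕ} (h : i < Nat.count p M) :
    p (Nat.nth p i) ∧ Nat.count p (Nat.nth p i) = i := by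
  have hi : ∀ hf : (Set.ofPred p).Finite, i < hf.toFinset.card :=
    fun hf => h.trans_le (Nat.count_le_card hf M)
  exact ⟨Nat.nth_mem i hi, Nat.count_nth hi⟩

namespace Honeycomb

variable {a e : ℕ} {f : quotWhite (2 * a) (e + 1) ≃ quotBlack (2 * a) (e + 1)}

open Classical in
/-- The chain of the vertical edges of a matching. -/
noncomputable def matchingChain (f : quotWhite (2 * a) (e + 1) ≃ quotBlack (2 * a) (e + 1))
    (x i : ℕ) : ℕ :=
  if x ≤ 2 * e + 1 ∧ i ≤ x / 2 then Nat.nth (IsVert f x) i else 0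

open Classical in
theorem matchingChain_spec
    (hf : f ∈ perfectMatchings (quotWhite (2 * a) (e + 1)) (quotBlack (2 * a) (e + 1)))
    {x i : ℕ} (hx : x ≤ 2 * e + 1) (hi : i ≤ x / 2) :
    IsVert f x (matchingChain f x i) ∧ Nat.count (IsVert f x) (matchingChain f x i) = i := by
  rw [matchingChain, if_pos ⟨hx, hi⟩]
  refine Nat.nth_spec_of_lt_count (M := a + x / 2 + 1) ?_
  rw [count_total hf hx]
  omega

open Classical in
theorem matchingChain_count
    (hf : f ∈ perfectMatchings (quotWhite (2 * a) (e + 1)) (quotBlack (2 * a) (e + 1)))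
    {x D : ℕ} (hx : x ≤ 2 * e + 1) (h : IsVert f x D) :
    Nat.count (IsVert f x) D ≤ x / 2 ∧
      matchingChain f x (Nat.count (IsVert f x) D) = D := by
  have h1 := Nat.count_strict_mono h (show D < a + x / 2 + 1 by have := h.1; omega)
  rw [count_total hf hx] at h1
  refine ⟨by omega, ?_⟩
  rw [matchingChain, if_pos ⟨hx, by omega⟩, Nat.nth_count h]

-- This turns inequalities between entries of neighbouring rows into inequalities between counts,
-- which the balance laws supply.
open Classical in
theorem matchingChain_lt_iff
    (hf : f ∈ perfectMatchings (quotWhite (2 * a) (e + 1)) (quotBlack (2 * a) (e + 1)))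
    {x i D : ℕ} (hx : x ≤ 2 * e + 1) (hi : i ≤ x / 2) :
    matchingChain f x i < D ↔ i < Nat.count (IsVert f x) D := by
  have h := matchingChain_spec hf hx hi
  constructor
  · intro h1
    have := Nat.count_strict_mono h.1 h1
    omega
  · intro h1
    by_contra! h2
    have := Nat.count_monotone (IsVert f x) h2
    omega

theorem matchingChain_mem
    (hf : f ∈ perfectMatchings (quotWhite (2 * a) (e + 1)) (quotBlack (2 * a) (e + 1))) :
    matchingChain f ∈ chains stairPre (2 * e + 1) (shiftRow a (e + 1)) := by
  classical
  rw [mem_chains]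
  refine ⟨?_, fun x hx => mem_boxFns.2 ⟨fun i hi => ?_, fun i hi => ?_⟩, fun x hx => ?_⟩
  · ext i
    rw [shiftRow]
    split_ifs with hi
    -- In the last row a vertical edge would leave the graph, so only the indices of the extension
    -- remain.
    · have hP : ∀ D, IsVert f (2 * e + 1) D ↔ a ≤ D ∧ D ≤ a + e := by
        intro D
        constructor
        · rintro ⟨h1, h2 | h2⟩
          · omega
          · obtain ⟨hw, -, h3⟩ := h2
            have h4 := (f ⟨_, hw⟩).2
            rw [h3] at h4
            simp only [rowWhite, e₁, Prod.mk_add_mk, mem_quotBlack] at h4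
            omega
        · rintro ⟨h1, h2⟩
          exact ⟨by omega, Or.inl (by omega)⟩
      have hc : ∀ i ≤ e, Nat.count (IsVert f (2 * e + 1)) (a + i) = i := by
        intro i hi
        induction i with
        | zero =>
          rw [Nat.count_iff_forall_not]
          intro D hD h
          have := (hP D).1 h
          omega
        | succ i ih =>
          rw [← add_assoc, Nat.count_succ, ih (by omega), if_pos ((hP _).2 (by omega))]
      have h1 := (matchingChain_count hf le_rfl ((hP (a + i)).2 (by omega))).2
      rwa [hc i (by omega)] at h1
    · rw [matchingChain, if_neg (by omega)]
  · rcases Nat.mod_two_eq_zero_or_one x with hm | hm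
    · have hm' : (x + 1) % 2 = 1 := by omega
      have hs := matchingChain_spec hf (x := x) hx.le (i := i) (by omega)
      have h1 : matchingChain f x i ≤ matchingChain f (x + 1) i := by
        have h2 := matchingChain_spec hf (x := x + 1) (i := i) (by omega) (by omega)
        have h3 := count_odd hf (x := x + 1) (by omega) hm' _ h2.1.1
        rw [if_neg fun h => not_isVert_of_hasEdge h (by decide) h2.1, Nat.count_succ (IsVert f (x + 1)),
          if_pos h2.1, h2.2, count_isVertPred (by omega), Nat.add_sub_cancel] at h3
        refine Nat.le_of_lt_add_one ((matchingChain_lt_iff hf hx.le (by omega)).2 (by omega))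
      have h4 : ∀ j, i = j + 1 → matchingChain f (x + 1) j < matchingChain f x i := by
        rintro j rfl
        rw [matchingChain_lt_iff hf (by omega) (by omega)]
        obtain ⟨D, hD⟩ : ∃ D, matchingChain f x (j + 1) = D + 1 := by
          refine Nat.exists_eq_succ_of_ne_zero fun h0 => ?_
          have := hs.2
          rw [h0, Nat.count_zero] at this
          omega
        rw [hD] at hs ⊢
        have h3 := count_odd hf (x := x + 1) (by omega) hm' D (by have := hs.1.1; omega)
        rw [if_neg fun h => not_isVertPred_odd_outward hm' h ⟨by omega, hs.1⟩,
          count_isVertPred (by omega), Nat.add_sub_cancel, hs.2] at h3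
        omega
      rw [if_pos hm]
      split_ifs with h0
      · subst h0
        exact mem_Iic.2 h1
      · exact mem_Ioc.2 ⟨h4 (i - 1) (by omega), h1⟩
    · have hm' : (x + 1) % 2 = 0 := by omega
      rw [if_neg (by omega), mem_Ico]
      constructor
      · have hs := matchingChain_spec hf (x := x) hx.le (i := i) (by omega)
        have h3 := count_even hf (x := x + 1) (by omega) hm' (matchingChain f x i + 1)
          (by have := hs.1.1; omega)
        rw [if_neg fun h => not_isVertPred_even_inward hm' h ⟨by omega, hs.1⟩,
          count_isVertPred (by omega), Nat.add_sub_cancel, Nat.count_succ (IsVert f x), if_pos hs.1,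
          hs.2] at h3
        refine Nat.le_of_lt_add_one ((matchingChain_lt_iff hf (by omega) (by omega)).2 (by omega))
      · have hs := matchingChain_spec hf (x := x + 1) (i := i + 1) (by omega) (by omega)
        have h3 := count_even hf (x := x + 1) (by omega) hm' _ hs.1.1
        rw [if_neg fun h => not_isVert_of_hasEdge h (by decide) hs.1, count_isVertPred (by omega),
          Nat.add_sub_cancel, hs.2] at h3
        rw [matchingChain_lt_iff hf hx.le (by omega)]
        omega
  · rw [matchingChain, if_neg (by omega)]
  · ext i
    rw [matchingChain, if_neg (by omega)]
    rfl

theorem isEntry_matchingChain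
    (hf : f ∈ perfectMatchings (quotWhite (2 * a) (e + 1)) (quotBlack (2 * a) (e + 1)))
    {x D : ℕ} (hx : x ≤ 2 * e + 1) :
    IsEntry a e (matchingChain f) (rowWhite a e x D) ↔ IsVert f x D := by
  classical
  constructor
  · rintro ⟨i, hi, h⟩
    have h1 := matchingChain_spec hf hx hi
    simp only [rowWhite] at h
    rw [show D = matchingChain f x i by omega]
    exact h1.1
  · intro h
    have h1 := matchingChain_count hf hx h
    refine ⟨_, h1.1, ?_⟩
    simp only [rowWhite]
    rw [h1.2]
    omega

/-- Without a vertical edge at `D`, the balance of counts decides between outward and inward. The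
index `j` in `IsOutward` is squeezed between the numbers of outgoing and incoming vertical edges
before the cut, and such a `j` exists only in the outward case. -/
theorem isOutward_matchingChain
    (hf : f ∈ perfectMatchings (quotWhite (2 * a) (e + 1)) (quotBlack (2 * a) (e + 1)))
    {x D : ℕ} (hx : x ≤ 2 * e + 1) (hD : D ≤ a + x / 2) (hv : ¬ IsVert f x D) :
    IsOutward a e (matchingChain f) (rowWhite a e x D) ↔ HasEdge f e₃ x D := by
  classical
  have hshift : a + e - x / 2 + D + x / 2 = a + e + D := by omega
  have hj : ∀ {j}, j ≤ x / 2 → (D < matchingChain f x j ↔ Nat.count (IsVert f x) D ≤ j) := by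
    intro j hj
    have h1 := matchingChain_lt_iff hf (D := D + 1) hx hj
    rw [Nat.count_succ, if_neg hv] at h1
    omega
  simp only [IsOutward, rowWhite, hshift]
  split_ifs with hm
  · constructor
    · rintro ⟨j, hjx, h1, h2⟩
      rcases white_cases hf hx hD with h | h | h
      · exact absurd h hv
      · exfalso
        have h3 := count_even hf hx hm D hD
        rw [if_pos h] at h3
        have h4 : Nat.count (IsVert f x) D ≤ j := (hj hjx).1 (by omega)
        have h5 : j ≤ Nat.count (IsVertPred f x) D := by
          rcases j with _ | j
          · exact Nat.zero_le _
          · rw [count_isVertPred (by omega)]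
            refine (matchingChain_lt_iff hf (by omega) (by omega)).1 ?_
            have := h1 j (by omega)
            omega
        omega
      · exact h
    · intro h
      have h3 := count_even hf hx hm D hD
      rw [if_neg fun h' => absurd (h.dir_eq h') (by decide)] at h3
      have h6 : ∀ l < Nat.count (IsVertPred f x) D, 0 < x ∧ l ≤ (x - 1) / 2 := by
        intro l hl
        have hx0 : 0 < x := by
          by_contra h0
          obtain rfl : x = 0 := by omega
          have : Nat.count (IsVertPred f 0) D = 0 := by
            rw [Nat.count_iff_forall_not]
            rintro D - ⟨h, -⟩
            exact lt_irrefl _ h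
          omega
        rw [count_isVertPred hx0] at hl
        have h7 := Nat.count_monotone (IsVert f (x - 1))
          (show D ≤ a + (x - 1) / 2 + 1 by omega)
        rw [count_total hf (by omega)] at h7
        omega
      refine ⟨Nat.count (IsVertPred f x) D, ?_, fun l hl => ?_, ?_⟩
      · by_contra! h8
        have := h6 _ h8
        have := h6 (Nat.count (IsVertPred f x) D - 1) (by omega)
        omega
      · obtain ⟨h8, h9⟩ := h6 l hl
        rw [count_isVertPred h8] at hl
        have := (matchingChain_lt_iff hf (x := x - 1) (D := D) (by omega) h9).2 hl
        omega
      · have h8 : Nat.count (IsVertPred f x) D ≤ x / 2 := by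
          by_contra! h8
          have := h6 (Nat.count (IsVertPred f x) D - 1) (by omega)
          omega
        have := (hj h8).2 h3.le
        omega
  · have hm : x % 2 = 1 := by omega
    have h3 := count_odd hf hx hm D hD
    rw [Nat.count_succ (IsVert f x), if_neg hv, count_isVertPred (by omega)] at h3
    constructor
    · rintro ⟨j, hjx, h1, h2⟩
      by_contra h
      rw [if_neg h] at h3
      have h4 := (hj hjx).1 (by omega)
      have h5 := (matchingChain_lt_iff hf (x := x - 1) (D := D + 1) (i := j) (by omega)
        (by omega)).1 (by omega)
      omega
    · intro h
      rw [if_pos h] at h3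
      have h7 := Nat.count_monotone (IsVert f (x - 1)) (show D + 1 ≤ a + (x - 1) / 2 + 1 by omega)
      rw [count_total hf (by omega)] at h7
      refine ⟨Nat.count (IsVert f x) D, by omega, ?_, ?_⟩
      · have := (matchingChain_lt_iff hf (x := x - 1) (D := D + 1)
          (i := Nat.count (IsVert f x) D) (by omega) (by omega)).2 (by omega)
        omega
      · have := (hj (j := Nat.count (IsVert f x) D) (by omega)).2 le_rfl
        omega

theorem chainMatching_matchingChain
    (hf : f ∈ perfectMatchings (quotWhite (2 * a) (e + 1)) (quotBlack (2 * a) (e + 1))) :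
    chainMatching (matchingChain_mem hf) = f := by
  ext ⟨⟨x, y, z⟩, hw⟩ : 2
  rw [chainMatching_apply]
  have hw' := mem_quotWhite.1 hw
  obtain ⟨D, hD⟩ : ∃ D, z + x / 2 = a + e + D := ⟨z + x / 2 - (a + e), by omega⟩
  obtain rfl : y = a + e - (x + 1) / 2 - D := by omega
  obtain rfl : z = a + e - x / 2 + D := by omega
  have hx : x ≤ 2 * e + 1 := by omega
  have h1 : D + (x + 1) / 2 ≤ a + e := by omega
  have h2 : D ≤ a + x / 2 := by omega
  change partner a e (matchingChain f) (rowWhite a e x D) = f ⟨rowWhite a e x D, hw⟩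
  rw [partner]
  split_ifs with h3 h4 <;> rw [isEntry_matchingChain hf hx] at h3
  · rcases h3.2 with h | ⟨_, -, h⟩
    · omega
    · exact h.symm
  · rw [isOutward_matchingChain hf hx h2 h3] at h4
    obtain ⟨_, -, h⟩ := h4
    exact h.symm
  · rw [isOutward_matchingChain hf hx h2 h3] at h4
    rcases white_cases hf hx h2 with h | h | h
    · exact absurd h h3
    · obtain ⟨_, -, h⟩ := h
      exact h.symm
    · exact absurd h h4

theorem numTCPPTwo_eq (a b : ℕ) :
    (numTCPPTwo (2 * a) b : ℚ) =
      ∏ j ∈ range b, ∏ i ∈ range (j + 1), ((2 * a + 1 + i + j : ℚ) / (1 + i + j)) := by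
  rcases b with _ | e
  -- For `b = 0` the graph is empty, and its only matching has weight 1.
  · have h1 : IsEmpty (quotWhite (2 * a) 0) := by
      rw [isEmpty_coe_sort]
      simp [quotWhite, white, region]
    have h2 : IsEmpty (quotBlack (2 * a) 0) := by
      rw [isEmpty_coe_sort]
      simp [quotBlack, black, region]
    have h3 : perfectMatchings (quotWhite (2 * a) 0) (quotBlack (2 * a) 0) = univ := by
      rw [perfectMatchings, filter_eq_self]
      exact fun _ _ w => h1.elim w
    rw [numTCPPTwo, h3]
    simp [Fintype.card_equiv (Equiv.equivOfIsEmpty (quotWhite (2 * a) 0) (quotBlack (2 * a) 0))]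
  · rw [← sum_chains_twoWeight_shiftRow, numTCPPTwo, Nat.cast_sum]
    symm
    refine sum_bij (fun c hc => chainMatching hc) (fun c hc => chainMatching_mem hc)
      (fun c hc d hd h => chainMatching_injective hc hd h)
      (fun f hf => ⟨matchingChain f, matchingChain_mem hf, chainMatching_matchingChain hf⟩)
      (fun c hc => (prod_edgeWeight_chainMatching hc).symm)

/-! ### Curvature and the assembly of the four statements. -/

theorem curvature_of_isQuotFace {m b : ℕ} {p : Vertex} (h : IsQuotFace m b p) :
    (FaceAtAxis p → curvature p = 2) ∧ (¬ FaceAtAxis p → curvature p = 1) := by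
  obtain ⟨x, y, z⟩ := p
  have hyz : y + 1 ≤ z := by
    have := (mem_filter.1 h.1.2.1).2
    simpa [e₂] using this
  -- Since `y + 1 ≤ z`, the only white vertex of the face that can be on the axis is `p + e₂`, and
  -- it is there exactly when `z = y + 1`. Then its edge to `p + e₂ + e₃` is the only one of weight
  -- 2, and it is in the numerator.
  by_cases hz : z = y + 1
  · subst hz
    have h1 : ¬ (y + 1 + 1 = y ∧ y = y + 1 + 1) := by omega
    simp [h1, FaceAtAxis, OnAxis, reflect, curvature, edgeWeight, e₁, e₂, e₃]
    norm_num
  · have h1 : z ≠ y := by omega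
    have h2 : z + 1 ≠ y := by omega
    have h3 : z + 1 ≠ y + 1 := by omega
    simp [FaceAtAxis, OnAxis, reflect, curvature, edgeWeight, e₁, e₂, e₃, hz, h1, h2]
    norm_num

end Honeycomb

theorem mainTheorem8 :
    -- the weighting: curvature 2 at the faces along the axis, flat at all other hexagons
    (∀ (m b : ℕ) (p : Honeycomb.Vertex), Honeycomb.IsQuotFace m b p →
      (Honeycomb.FaceAtAxis p → Honeycomb.curvature p = 2) ∧
      (¬ Honeycomb.FaceAtAxis p → Honeycomb.curvature p = 1)) ∧
    -- the relation from the reflection symmetry of `Z(2a, b, b)`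
    (∀ a b : ℕ, numPP (2 * a) b b = numTCPP (2 * a) b * Honeycomb.numTCPPTwo (2 * a) b) ∧
    -- the relation from the reflection symmetry of `Z(2a + 1, b, b)`
    (∀ a b : ℕ, 1 ≤ b →
      numPP (2 * a + 1) b b =
        2 * numTCPP (2 * a) (b + 1) * Honeycomb.numTCPPTwo (2 * a + 2) (b - 1)) ∧
    -- the product formula
    (∀ a b : ℕ, 1 ≤ b →
      (numTCPP (2 * a) b : ℚ) =
        ((a + b - 1).choose (b - 1) : ℚ) *
          ∏ i ∈ Finset.Icc 1 (b - 2), ∏ j ∈ Finset.Icc i (b - 2),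
            ((2 * a + i + j + 1 : ℚ) / (i + j + 1 : ℚ))) := by
  refine ⟨fun m b p h => Honeycomb.curvature_of_isQuotFace h, fun a b => ?_, fun a b hb => ?_,
    fun a b hb => ?_⟩
  · have h : (numPP (2 * a) b b : ℚ) = numTCPP (2 * a) b * Honeycomb.numTCPPTwo (2 * a) b := by
      rw [numPP_eq, Honeycomb.numTCPPTwo_eq]
      rcases b with _ | n
      · simp [numTCPP_zero]
      · rw [numTCPP_eq]
        -- The triangle shifted by one gives the TCPPs, the unshifted one the 2-enumeration.
        convert prod_square_eq_prod_triangle_mul (fun s => (2 * a + 1 + s : ℚ) / (1 + s)) n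
          using 1
        · refine prod_congr rfl fun j _ => prod_congr rfl fun i _ => ?_
          push_cast
          ring
        · congr 1
          · refine prod_congr rfl fun j _ => prod_congr rfl fun i _ => ?_
            push_cast
            congr 1 <;> ring
          · refine prod_congr rfl fun j _ => prod_congr rfl fun i _ => ?_
            push_cast
            congr 1 <;> ring
    exact_mod_cast h
  · obtain ⟨n, rfl⟩ : ∃ n, b = n + 1 := ⟨b - 1, by omega⟩
    have h : (numPP (2 * a + 1) (n + 1) (n + 1) : ℚ) =
        2 * numTCPP (2 * a) (n + 1 + 1) * Honeycomb.numTCPPTwo (2 * (a + 1)) n := by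
      rw [numPP_eq, Honeycomb.numTCPPTwo_eq, numTCPP_eq]
      convert prod_square_eq_two_mul_prod_triangle_mul (a : ℚ) n using 1
      · refine prod_congr rfl fun j _ => prod_congr rfl fun i _ => ?_
        push_cast
        congr 1
        ring
      · congr 1
        refine prod_congr rfl fun j _ => prod_congr rfl fun i _ => ?_
        push_cast
        congr 1
        ring
    rw [Nat.add_sub_cancel]
    exact_mod_cast h
  · obtain ⟨n, rfl⟩ : ∃ n, b = n + 1 := ⟨b - 1, by omega⟩
    rw [numTCPP_eq, prod_triangle_eq_choose_mul, prod_Icc_prod_Icc, Nat.add_sub_cancel,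
      show a + (n + 1) - 1 = a + n by omega, show n + 1 - 2 = n - 1 by omega]
    congr 1
    refine prod_congr rfl fun j _ => prod_congr rfl fun i _ => ?_
    push_cast
    congr 1 <;> ring
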